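/- Let $d,m$ be natural numbers, $T>0$, $\lambda\ge 0$, and let $A\subset\mathbb{R}^m$ be nonempty and compact. Let $f:\mathbb{R}^d\times A\to\mathbb{R}^d$ be continuous and bounded, with $\|f(x,a)-f(y,a)\|\le L\|x-y\|$ for some $L>0$ and all $x,y\in\mathbb{R}^d$, $a\in A$. Let $\psi:\mathbb{R}^d\times[0,T]\to[0,\infty)$ be bounded and uniformly continuous, and let $\ell:\mathbb{R}^d\times A\times[0,T]\to[0,\infty)$ be bounded, continuous and such that $|\ell(x,a,t)-\ell(y,a,t)|\le\omega_\ell(\|x-y\|)$ for all $x,y,a,t$, for some modulus of continuity $\omega_\ell$ (that is, $\omega_\ell(r)\to0=\omega_\ell(0)$ as $r\to0^+$). Let $\mathcal A$ be the set of measurable functions $\alpha:[0,\infty)\to A$. For $(x,t)\in\mathbb{R}^d\times[0,T]$ and $\alpha\in\mathcal A$ let $y_{(x,t)}(\cdot;\alpha)$ be the unique absolutely continuous solution of $y'(s)=f(y(s),\alpha(s))$ for a.e. $s\in(t,T]$, $y(t)=x$. For $\tau\in[t,T]$ put $$J(x,t,\alpha,\tau)=\int_t^\tau e^{-\lambda(s-t)}\ell(y_{(x,t)}(s;\alpha),\alpha(s),s)\,ds+e^{-\lambda(\tau-t)}\psi(y_{(x,t)}(\tau;\alpha),\tau),$$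 $$V(x,t)=\inf_{\alpha\in\mathcal A,\ \tau\in[t,T]}J(x,t,\alpha,\tau),\qquad H(x,t,\xi)=\sup_{a\in A}\{-f(x,a)\cdot\xi-\ell(x,a,t)\}.$$ Consider the obstacle problem $$\max\{u-\psi,\ -u_t+\lambda u+H(x,t,D_xu)\}=0\ \text{ on }\mathbb{R}^d\times[0,T),\qquad u(x,T)=\psi(x,T)\ \text{ for }x\in\mathbb{R}^d.\qquad(1)$$ A bounded uniformly continuous function $u$ on $\mathbb{R}^d\times[0,T]$ is a viscosity solution of (1) if $u(\cdot,T)=\psi(\cdot,T)$ and, for every $\varphi\in C^1(\mathbb{R}^d\times\mathbb{R})$ and every $(x,t)\in\mathbb{R}^d\times[0,T)$, the quantity $$\max\{u(x,t)-\psi(x,t),\ -\varphi_t(x,t)+\lambda u(x,t)+H(x,t,D_x\varphi(x,t))\}$$ is $\le0$ if $u-\varphi$ has a local maximum at $(x,t)$ relative to $\mathbb{R}^d\times[0,T)$, and is $\ge0$ if $u-\varphi$ has a local minimum at $(x,t)$ relative to $\mathbb{R}^d\times[0,T)$. Then: (a) For every bounded uniformly continuous viscosity solution $u$ of (1) and every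 $(x,t)\in\mathbb{R}^d\times[0,T]$, $$u(x,t)=\inf_{\alpha\in\mathcal A}J(x,t,\alpha,\tau^*_{(x,t)}(\alpha))=V(x,t),$$ where $\tau^*_{(x,t)}(\alpha)=\inf\{\tau\in[t,T]:u(y_{(x,t)}(\tau;\alpha),\tau)=\psi(y_{(x,t)}(\tau;\alpha),\tau)\}$. (b) $V$ is itself a bounded uniformly continuous viscosity solution of (1). Hence, by (a), it is the unique one. -/

import Mathlib

open Set Filter Topology MeasureTheory

noncomputable section

/-- The data of a finite-horizon, time-dependent optimal stopping problem in `ℝ^d` with controls in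
`ℝ^m`. Only the values of `f` on `ℝ^d × A`, of `ℓ` on `ℝ^d × A × [0, T]` and of `ψ` on
`ℝ^d × [0, T]` matter. -/
structure StoppingProblem (d m : ℕ) where
  /-- the control set -/
  A : Set (EuclideanSpace ℝ (Fin m))
  /-- the horizon -/
  T : ℝ
  /-- the dynamics -/
  f : EuclideanSpace ℝ (Fin d) → EuclideanSpace ℝ (Fin m) → EuclideanSpace ℝ (Fin d)
  /-- the running cost -/
  ℓ : EuclideanSpace ℝ (Fin d) → EuclideanSpace ℝ (Fin m) → ℝ → ℝ
  /-- the stopping cost -/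
  ψ : EuclideanSpace ℝ (Fin d) → ℝ → ℝ
  /-- the discount factor -/
  lam : ℝ

namespace StoppingProblem

variable {d m : ℕ} (P : StoppingProblem d m)

/-- The measurable controls `α : [0, ∞) → A` (values at negative times are irrelevant). -/
def controls : Set (ℝ → EuclideanSpace ℝ (Fin m)) :=
  {α | Measurable ((Ici (0 : ℝ)).domRestrict α) ∧ ∀ s : ℝ, 0 ≤ s → α s ∈ P.A}

/-- `y` is a (Carathéodory, i.e. absolutely continuous) solution on `[t, T]` of
`y' = f (y, α)`, `y t = x`, written as an integral equation. -/
def IsTrajectory (x : EuclideanSpace ℝ (Fin d)) (t : ℝ) (α : ℝ → EuclideanSpace ℝ (Fin m))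
    (y : ℝ → EuclideanSpace ℝ (Fin d)) : Prop :=
  ContinuousOn y (Icc t P.T) ∧
    ∀ s ∈ Icc t P.T, IntervalIntegrable (fun r => P.f (y r) (α r)) volume t s ∧
      y s = x + ∫ r in t..s, P.f (y r) (α r)

open Classical in
/-- The trajectory `y_{(x,t)}(·; α)`; for bounded Lipschitz dynamics it exists and it is unique
on `[t, T]`. -/
def traj (x : EuclideanSpace ℝ (Fin d)) (t : ℝ) (α : ℝ → EuclideanSpace ℝ (Fin m)) :
    ℝ → EuclideanSpace ℝ (Fin d) :=
  if h : ∃ y, P.IsTrajectory x t α y then h.choose else fun _ => x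

/-- The cost `J(x, t, α, τ)`. -/
def J (x : EuclideanSpace ℝ (Fin d)) (t : ℝ) (α : ℝ → EuclideanSpace ℝ (Fin m)) (τ : ℝ) : ℝ :=
  (∫ s in t..τ, Real.exp (-P.lam * (s - t)) * P.ℓ (P.traj x t α s) (α s) s) +
    Real.exp (-P.lam * (τ - t)) * P.ψ (P.traj x t α τ) τ

/-- The value function `V(x, t)`, the infimum of the cost over controls `α` and stopping times
`τ ∈ [t, T]`. -/
def V (x : EuclideanSpace ℝ (Fin d)) (t : ℝ) : ℝ :=
  ⨅ q : P.controls × Icc t P.T, P.J x t q.1 q.2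

/-- The Hamiltonian `H(x, t, ξ)`. -/
def H (x : EuclideanSpace ℝ (Fin d)) (t : ℝ) (ξ : EuclideanSpace ℝ (Fin d)) : ℝ :=
  ⨆ a : P.A, (-inner ℝ (P.f x a) ξ - P.ℓ x a t)

/-- The left-hand side `max {r - ψ(x,t), -q + λ r + H(x,t,ξ)}` of the obstacle problem, with `r`,
`q`, `ξ` in the places of `u`, `u_t`, `D_x u`. -/
def obstacleOp (x : EuclideanSpace ℝ (Fin d)) (t r q : ℝ) (ξ : EuclideanSpace ℝ (Fin d)) : ℝ :=
  max (r - P.ψ x t) (-q + P.lam * r + P.H x t ξ)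

/-- Bounded and uniformly continuous on `ℝ^d × [0, T]`. -/
def IsBUC (u : EuclideanSpace ℝ (Fin d) → ℝ → ℝ) : Prop :=
  (∃ C : ℝ, ∀ x, ∀ t ∈ Icc 0 P.T, |u x t| ≤ C) ∧
    UniformContinuousOn (fun z : EuclideanSpace ℝ (Fin d) × ℝ => u z.1 z.2)
      (univ ×ˢ Icc 0 P.T)

/-- Viscosity subsolution of the obstacle equation on `ℝ^d × [0, T)`; local maxima are relative to
this set. -/
def IsViscositySubsolution (u : EuclideanSpace ℝ (Fin d) → ℝ → ℝ) : Prop :=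
  ∀ φ : EuclideanSpace ℝ (Fin d) × ℝ → ℝ, ContDiff ℝ 1 φ →
    ∀ x, ∀ t ∈ Ico 0 P.T,
      IsLocalMaxOn (fun z : EuclideanSpace ℝ (Fin d) × ℝ => u z.1 z.2 - φ z)
        (univ ×ˢ Ico 0 P.T) (x, t) →
      P.obstacleOp x t (u x t) (deriv (fun s => φ (x, s)) t) (gradient (fun z => φ (z, t)) x) ≤ 0

/-- Viscosity supersolution of the obstacle equation on `ℝ^d × [0, T)`; local minima are relative to
this set. -/
def IsViscositySupersolution (u : EuclideanSpace ℝ (Fin d) → ℝ → ℝ) : Prop :=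
  ∀ φ : EuclideanSpace ℝ (Fin d) × ℝ → ℝ, ContDiff ℝ 1 φ →
    ∀ x, ∀ t ∈ Ico 0 P.T,
      IsLocalMinOn (fun z : EuclideanSpace ℝ (Fin d) × ℝ => u z.1 z.2 - φ z)
        (univ ×ˢ Ico 0 P.T) (x, t) →
      0 ≤ P.obstacleOp x t (u x t) (deriv (fun s => φ (x, s)) t) (gradient (fun z => φ (z, t)) x)

/-- `u` is a `BUC` viscosity solution of the obstacle problem with its terminal condition. -/
structure IsBUCViscositySolution (u : EuclideanSpace ℝ (Fin d) → ℝ → ℝ) : Prop where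
  buc : P.IsBUC u
  sub : P.IsViscositySubsolution u
  super : P.IsViscositySupersolution u
  terminal : ∀ x, u x P.T = P.ψ x P.T

/-- The first time `τ*_{(x,t)}(α)` at which `u` meets `ψ` along the trajectory. -/
def hitTime (u : EuclideanSpace ℝ (Fin d) → ℝ → ℝ) (x : EuclideanSpace ℝ (Fin d)) (t : ℝ)
    (α : ℝ → EuclideanSpace ℝ (Fin m)) : ℝ :=
  sInf {τ | τ ∈ Icc t P.T ∧ u (P.traj x t α τ) τ = P.ψ (P.traj x t α τ) τ}

end StoppingProblem

end

/-!
The value function `V` is the unique bounded uniformly continuous viscosity solution of the obstacle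
problem, and stopping at the first contact of `V` with the obstacle is optimal.

*Trajectories.* The controls are only measurable in time, so the trajectories are constructed here,
as fixed points of the Picard operator (`exists_integral_solution`). Grönwall's inequality gives
uniqueness, Lipschitz dependence on the initial state and the flow property
(`IsRegular.norm_sub_le_of_isTrajectory`, `IsRegular.traj_traj`).

*`V` is a solution.* Write `cost W x t α σ` for the cost of following `α` until time `σ` and paying
`W` there. The flow property gives the two halves of the dynamic programming principle:
`V x t ≤ cost V x t α σ` always (`IsRegular.V_le_cost_V`), and `cost V x t α σ ≤ J x t α τ` for
`σ ≤ τ` (`IsRegular.cost_V_le_J`). With the bound on the speed of trajectories they give the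
continuity of `V` in time, and with a first-order expansion of a test function along trajectories,
uniform over all controls (`IsRegular.eventually_abs_expansion_le`), the two viscosity inequalities.
For the supersolution inequality one may assume `V < ψ` at the point; then almost optimal stopping
times are bounded away from the initial time.

*Uniqueness.* The comparison principle `IsRegular.le_of_sub_super` is proved by doubling the
variables. At a maximum point of the doubled difference the bounds by the obstacle cancel up to the
modulus of continuity of `ψ`, so the supersolution satisfies the Hamilton–Jacobi inequality there
and the classical argument applies. Hence every solution equals `V`.

*The first contact time.* Given a control and a time, continuing with an `ε`-optimal pair produces a
time at which `ψ - V` is of order `ε` (`IsRegular.exists_continuation`). Iterating with summable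
tolerances gives an increasing sequence of times and one control glued from the pieces; at the limit
time `ψ = V`, and the cost up to there exceeds `V` only by the sum of the tolerances
(`IsRegular.exists_J_hitTime_le`). Stopping even earlier, at the first contact, costs no more by
dynamic programming.
-/

/-! ### Integral equations: Grönwall's inequality and Picard iteration -/

/-- Composing a function that is continuous on a measurable set with a measurable function that
takes its values there gives an a.e. strongly measurable function. -/
theorem ContinuousOn.aestronglyMeasurable_comp_of_mem {Ω X Y : Type*} [MeasurableSpace Ω]
    {μ : Measure Ω} [TopologicalSpace X] [MeasurableSpace X] [OpensMeasurableSpace X]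
    [NormedAddCommGroup Y] [MeasurableSpace Y] [BorelSpace Y]
    [SecondCountableTopology Y] {g : X → Y} {K : Set X} {h : Ω → X} {S : Set Ω}
    (hg : ContinuousOn g K) (hK : MeasurableSet K) (hS : MeasurableSet S)
    (hh : AEMeasurable h (μ.restrict S)) (hmem : ∀ s ∈ S, h s ∈ K) :
    AEStronglyMeasurable (fun s => g (h s)) (μ.restrict S) := by
  classical
  have h1 : Measurable (K.piecewise g fun _ => (0 : Y)) :=
    hg.measurable_piecewise continuousOn_const hK
  refine ((h1.comp_aemeasurable hh).congr ?_).aestronglyMeasurable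
  filter_upwards [ae_restrict_mem hS] with s hs
  simp [Set.piecewise, hmem s hs]

/-- Grönwall's inequality in integral form. -/
theorem le_mul_exp_of_le_add_integral {g : ℝ → ℝ} {C L a b : ℝ} (hL : 0 ≤ L)
    (hg : ContinuousOn g (Icc a b))
    (h : ∀ s ∈ Icc a b, g s ≤ C + L * ∫ r in a..s, g r) :
    ∀ s ∈ Icc a b, g s ≤ C * Real.exp (L * (s - a)) := by
  intro s hs
  have hab : a ≤ b := hs.1.trans hs.2
  have hint : IntervalIntegrable g volume a b := by
    apply ContinuousOn.intervalIntegrable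
    rwa [uIcc_of_le hab]
  have hcont : ContinuousOn (fun s => C + L * ∫ r in a..s, g r) (Icc a b) := by
    have := intervalIntegral.continuousOn_primitive_interval (μ := volume) (f := g) (a := a) (b := b)
      (by rw [uIcc_of_le hab]; exact hg.integrableOn_Icc)
    rw [uIcc_of_le hab] at this
    exact continuousOn_const.add (continuousOn_const.mul this)
  have hder : ∀ x ∈ Ico a b,
      HasDerivWithinAt (fun s => C + L * ∫ r in a..s, g r) (L * g x) (Ici x) x := by
    intro x hx
    have hcx : ContinuousWithinAt g (Ioi x) x :=
      ((hg x ⟨hx.1, hx.2.le⟩).mono_of_mem_nhdsWithin (by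
        filter_upwards [Ioo_mem_nhdsGT hx.2] with z hz using ⟨hx.1.trans hz.1.le, hz.2.le⟩))
    have hm : StronglyMeasurableAtFilter g (𝓝[>] x) :=
      ⟨Ioo x b, Ioo_mem_nhdsGT hx.2, ((hg.mono fun z hz =>
        ⟨hx.1.trans hz.1.le, hz.2.le⟩).aestronglyMeasurable measurableSet_Ioo)⟩
    have h1 : HasDerivWithinAt (fun u => ∫ r in a..u, g r) (g x) (Ici x) x :=
      intervalIntegral.integral_hasDerivWithinAt_right
        (hint.mono_set (by
          rw [uIcc_of_le hx.1, uIcc_of_le hab]; exact Icc_subset_Icc_right hx.2.le)) hm hcx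
    exact (h1.const_mul L).const_add C
  have := le_gronwallBound_of_liminf_deriv_right_le (f := fun s => C + L * ∫ r in a..s, g r)
    (f' := fun x => L * g x) (δ := C) (K := L) (ε := 0) (a := a) (b := b) hcont
    (fun x hx r hr => (hder x hx).liminf_right_slope_le hr) (by simp)
    (fun x hx => by
      have := h x ⟨hx.1, hx.2.le⟩
      simpa using mul_le_mul_of_nonneg_left this hL) s hs
  rw [gronwallBound_ε0] at this
  exact (h s hs).trans this

/-- Existence for `y s = x + ∫ r in t..s, g r (y r)` when `g` is Lipschitz in the state and only
measurable in time. Substituting `y s = exp (2 L (s - t)) * z s` turns the Picard operator into a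
`1/2`-contraction of the space of continuous functions on `[t, T]`. -/
theorem exists_integral_solution {E : Type*} [NormedAddCommGroup E] [NormedSpace ℝ E]
    [CompleteSpace E] {g : ℝ → E → E} {t T L : ℝ} (htT : t ≤ T) (hL : 0 < L)
    (hlip : ∀ r ∈ Icc t T, ∀ v w, ‖g r v - g r w‖ ≤ L * ‖v - w‖)
    (hint : ∀ y : ℝ → E, ContinuousOn y (Icc t T) →
      IntervalIntegrable (fun r => g r (y r)) volume t T) (x : E) :
    ∃ y : ℝ → E, ContinuousOn y (Icc t T) ∧
      ∀ s ∈ Icc t T, y s = x + ∫ r in t..s, g r (y r) := by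
  set Y : C(Icc t T, E) → ℝ → E := fun z r => Real.exp (2 * L * (r - t)) • IccExtend htT z r
  have hYc : ∀ z, Continuous (Y z) := fun z => by
    have : Continuous (IccExtend htT z) := z.continuous.Icc_extend'
    fun_prop
  have hI : ∀ z, IntervalIntegrable (fun r => g r (Y z r)) volume t T :=
    fun z => hint _ (hYc z).continuousOn
  have hIs : ∀ z, ∀ s ∈ Icc t T, IntervalIntegrable (fun r => g r (Y z r)) volume t s :=
    fun z s hs => (hI z).mono_set (by
      rw [uIcc_of_le htT, uIcc_of_le hs.1]; exact Icc_subset_Icc_right hs.2)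
  have hcont : ∀ z, ContinuousOn (fun s => ∫ r in t..s, g r (Y z r)) (Icc t T) := by
    intro z
    have := intervalIntegral.continuousOn_primitive_interval' (hI z) left_mem_uIcc
    rwa [uIcc_of_le htT] at this
  let Φ : C(Icc t T, E) → C(Icc t T, E) := fun z =>
    ⟨fun s => Real.exp (-(2 * L * (s - t))) • (x + ∫ r in t..(s : ℝ), g r (Y z r)), by
      have := continuousOn_iff_continuous_domRestrict.1 (hcont z)
      have h2 : Continuous fun s : Icc t T => ∫ r in t..(s : ℝ), g r (Y z r) := this
      fun_prop⟩
  have hΦ : ContractingWith (1 / 2) Φ := by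
    refine ⟨by norm_num [← NNReal.coe_lt_coe], LipschitzWith.of_dist_le_mul fun z w => ?_⟩
    rw [ContinuousMap.dist_le (by positivity)]
    intro s
    have hs := s.2
    have hdiff : ∀ r ∈ Icc t (s : ℝ),
        ‖g r (Y z r) - g r (Y w r)‖ ≤ L * Real.exp (2 * L * (r - t)) * dist z w := by
      intro r hr
      refine (hlip r ⟨hr.1, hr.2.trans hs.2⟩ _ _).trans ?_
      rw [mul_assoc]
      refine mul_le_mul_of_nonneg_left ?_ hL.le
      simp only [Y]
      rw [← smul_sub, norm_smul, Real.norm_eq_abs, abs_of_pos (Real.exp_pos _)]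
      refine mul_le_mul_of_nonneg_left ?_ (Real.exp_pos _).le
      rw [← dist_eq_norm]
      exact ContinuousMap.dist_apply_le_dist _
    have hval : ∫ r in t..(s : ℝ), L * Real.exp (2 * L * (r - t)) * dist z w =
        (Real.exp (2 * L * (s - t)) - 1) / 2 * dist z w := by
      rw [intervalIntegral.integral_mul_const]
      congr 1
      rw [intervalIntegral.integral_eq_sub_of_hasDerivAt
        (f := fun r => Real.exp (2 * L * (r - t)) / 2)]
      · simp; ring
      · intro r _
        have h1 : HasDerivAt (fun r => 2 * L * (r - t)) (2 * L * 1) r :=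
          ((hasDerivAt_id r).sub_const t).const_mul (2 * L)
        exact ((h1.exp).div_const 2).congr_deriv (by ring)
      · exact Continuous.intervalIntegrable (by fun_prop) _ _
    have hbound : ‖(∫ r in t..(s : ℝ), g r (Y z r)) - ∫ r in t..(s : ℝ), g r (Y w r)‖ ≤
        (Real.exp (2 * L * (s - t)) - 1) / 2 * dist z w := by
      rw [← intervalIntegral.integral_sub (hIs z s hs) (hIs w s hs), ← hval]
      refine intervalIntegral.norm_integral_le_of_norm_le hs.1 ?_ ?_
      · exact ae_of_all _ fun r hr => hdiff r ⟨hr.1.le, hr.2⟩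
      · exact Continuous.intervalIntegrable (by fun_prop) _ _
    change dist (Real.exp (-(2 * L * (s - t))) • (x + ∫ r in t..(s : ℝ), g r (Y z r)))
      (Real.exp (-(2 * L * (s - t))) • (x + ∫ r in t..(s : ℝ), g r (Y w r))) ≤ _
    rw [dist_eq_norm, ← smul_sub, norm_smul, Real.norm_eq_abs, abs_of_pos (Real.exp_pos _),
      add_sub_add_left_eq_sub]
    have he : Real.exp (-(2 * L * (s - t))) * Real.exp (2 * L * (s - t)) = 1 := by
      rw [← Real.exp_add]; simp
    have hp := Real.exp_pos (-(2 * L * (s - t)))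
    calc _ ≤ Real.exp (-(2 * L * (s - t))) *
          ((Real.exp (2 * L * (s - t)) - 1) / 2 * dist z w) :=
          mul_le_mul_of_nonneg_left hbound hp.le
      _ = (1 - Real.exp (-(2 * L * (s - t)))) / 2 * dist z w := by
          linear_combination (1 / 2 * dist z w) * he
      _ ≤ _ := by
          refine mul_le_mul_of_nonneg_right ?_ dist_nonneg
          simp only [NNReal.coe_div, NNReal.coe_one, NNReal.coe_ofNat]
          linarith
  have : Nonempty C(Icc t T, E) := ⟨0⟩
  set z := hΦ.fixedPoint Φ
  have hz : Φ z = z := hΦ.fixedPoint_isFixedPt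
  refine ⟨Y z, (hYc z).continuousOn, fun s hs => ?_⟩
  have h1 : IccExtend htT z s = Φ z ⟨s, hs⟩ := by rw [hz, IccExtend_of_mem htT _ hs]
  simp only [Y]
  rw [h1]
  change Real.exp (2 * L * (s - t)) •
    (Real.exp (-(2 * L * (s - t))) • (x + ∫ r in t..s, g r (Y z r))) = _
  rw [smul_smul, ← Real.exp_add]
  simp [Y]

noncomputable section

/-! ### Controlled trajectories -/

namespace StoppingProblem

/-- The standing assumptions on the data, with explicit constants: `M` bounds `f`, `L` is the
Lipschitz constant of `f` in the state, and `C` bounds both `ψ` and `ℓ`. -/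
structure IsRegular {d m : ℕ} (P : StoppingProblem d m) (M L C : ℝ) : Prop where
  T_pos : 0 < P.T
  lam_nonneg : 0 ≤ P.lam
  isCompact : IsCompact P.A
  nonempty : P.A.Nonempty
  f_cont : ContinuousOn
    (fun z : EuclideanSpace ℝ (Fin d) × EuclideanSpace ℝ (Fin m) => P.f z.1 z.2) (univ ×ˢ P.A)
  f_le : ∀ x, ∀ a ∈ P.A, ‖P.f x a‖ ≤ M
  L_pos : 0 < L
  f_lip : ∀ x y, ∀ a ∈ P.A, ‖P.f x a - P.f y a‖ ≤ L * ‖x - y‖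
  ψ_nonneg : ∀ x, ∀ t ∈ Icc 0 P.T, 0 ≤ P.ψ x t
  ψ_le : ∀ x, ∀ t ∈ Icc 0 P.T, P.ψ x t ≤ C
  ψ_cont : UniformContinuousOn (fun z : EuclideanSpace ℝ (Fin d) × ℝ => P.ψ z.1 z.2)
    (univ ×ˢ Icc 0 P.T)
  ℓ_nonneg : ∀ x, ∀ a ∈ P.A, ∀ t ∈ Icc 0 P.T, 0 ≤ P.ℓ x a t
  ℓ_le : ∀ x, ∀ a ∈ P.A, ∀ t ∈ Icc 0 P.T, P.ℓ x a t ≤ C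
  ℓ_cont : ContinuousOn
    (fun z : EuclideanSpace ℝ (Fin d) × EuclideanSpace ℝ (Fin m) × ℝ => P.ℓ z.1 z.2.1 z.2.2)
    (univ ×ˢ P.A ×ˢ Icc 0 P.T)
  ℓ_unif : ∀ ε > 0, ∃ δ > 0, ∀ x y, ∀ a ∈ P.A, ∀ t ∈ Icc 0 P.T, ‖x - y‖ < δ →
    |P.ℓ x a t - P.ℓ y a t| < ε

variable {d m : ℕ} {P : StoppingProblem d m} {M L C : ℝ}
  {x x' : EuclideanSpace ℝ (Fin d)} {t s τ σ : ℝ} {α β : ℝ → EuclideanSpace ℝ (Fin m)}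
  {y y' : ℝ → EuclideanSpace ℝ (Fin d)}

namespace IsRegular

theorem C_nonneg (h : P.IsRegular M L C) : 0 ≤ C :=
  (h.ψ_nonneg 0 0 ⟨le_rfl, h.T_pos.le⟩).trans (h.ψ_le 0 0 ⟨le_rfl, h.T_pos.le⟩)

theorem M_nonneg (h : P.IsRegular M L C) : 0 ≤ M :=
  let ⟨a, ha⟩ := h.nonempty
  (norm_nonneg _).trans (h.f_le 0 a ha)

end IsRegular

theorem aemeasurable_control (hα : α ∈ P.controls) (ht : 0 ≤ t) :
    AEMeasurable α (volume.restrict (Icc t s)) := by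
  have h1 : AEMeasurable α (volume.restrict (Ici 0)) :=
    aemeasurable_restrict_of_measurable_subtype measurableSet_Ici hα.1
  exact h1.mono_measure (Measure.restrict_mono (fun r hr => ht.trans hr.1) le_rfl)

theorem const_mem_controls {a : EuclideanSpace ℝ (Fin m)} (ha : a ∈ P.A) :
    (fun _ => a) ∈ P.controls :=
  ⟨measurable_const, fun _ _ => ha⟩

namespace IsRegular

theorem intervalIntegrable_f (h : P.IsRegular M L C) (hα : α ∈ P.controls) (ht : 0 ≤ t)
    (hts : t ≤ s) (hy : ContinuousOn y (Icc t s)) :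
    IntervalIntegrable (fun r => P.f (y r) (α r)) volume t s := by
  rw [intervalIntegrable_iff_integrableOn_Icc_of_le hts]
  have h1 : AEStronglyMeasurable (fun r => P.f (y r) (α r)) (volume.restrict (Icc t s)) :=
    h.f_cont.aestronglyMeasurable_comp_of_mem (h := fun r => (y r, α r))
      (MeasurableSet.univ.prod h.isCompact.measurableSet) measurableSet_Icc
      ((hy.aemeasurable measurableSet_Icc).prodMk (aemeasurable_control hα ht))
      (fun r hr => ⟨trivial, hα.2 r (ht.trans hr.1)⟩)
  refine Integrable.of_bound h1 M ?_
  filter_upwards [ae_restrict_mem measurableSet_Icc] with r hr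
  exact h.f_le _ _ (hα.2 r (ht.trans hr.1))

theorem exists_isTrajectory (h : P.IsRegular M L C) (hα : α ∈ P.controls)
    (ht : t ∈ Icc 0 P.T) (x : EuclideanSpace ℝ (Fin d)) : ∃ y, P.IsTrajectory x t α y := by
  obtain ⟨y, hy, hy'⟩ := exists_integral_solution (g := fun r v => P.f v (α r)) ht.2 h.L_pos
    (fun r hr v w => h.f_lip v w _ (hα.2 r (ht.1.trans hr.1)))
    (fun y hy => h.intervalIntegrable_f hα ht.1 ht.2 hy) x
  exact ⟨y, hy, fun s hs => ⟨h.intervalIntegrable_f hα ht.1 hs.1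
    (hy.mono (Icc_subset_Icc_right hs.2)), hy' s hs⟩⟩

theorem isTrajectory_traj (h : P.IsRegular M L C) (hα : α ∈ P.controls)
    (ht : t ∈ Icc 0 P.T) (x : EuclideanSpace ℝ (Fin d)) :
    P.IsTrajectory x t α (P.traj x t α) := by
  have hex := h.exists_isTrajectory hα ht x
  rw [traj, dif_pos hex]
  exact hex.choose_spec

/-- Continuous dependence of trajectories on the initial state, for controls that agree up to the
time of comparison. -/
theorem norm_sub_le_of_isTrajectory (h : P.IsRegular M L C) (hα : α ∈ P.controls) (ht : 0 ≤ t)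
    (hσ : σ ∈ Icc t P.T) (hαβ : EqOn α β (Ioo t σ)) (hy : P.IsTrajectory x t α y)
    (hy' : P.IsTrajectory x' t β y') :
    ∀ s ∈ Icc t σ, ‖y s - y' s‖ ≤ ‖x - x'‖ * Real.exp (L * (s - t)) := by
  have hsub : Icc t σ ⊆ Icc t P.T := Icc_subset_Icc_right hσ.2
  have hc : ContinuousOn (fun s => ‖y s - y' s‖) (Icc t σ) :=
    ((hy.1.mono hsub).sub (hy'.1.mono hsub)).norm
  refine le_mul_exp_of_le_add_integral h.L_pos.le hc fun s hs => ?_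
  have hsT := hsub hs
  have e : ∫ r in t..s, P.f (y' r) (β r) = ∫ r in t..s, P.f (y' r) (α r) :=
    intervalIntegral.integral_congr_Ioo_of_le hs.1 fun r hr => by
      simp only [hαβ ⟨hr.1, hr.2.trans_le hs.2⟩]
  rw [(hy.2 s hsT).2, (hy'.2 s hsT).2, e, add_sub_add_comm]
  refine (norm_add_le _ _).trans (add_le_add_right ?_ _)
  rw [← intervalIntegral.integral_sub (hy.2 s hsT).1
    (h.intervalIntegrable_f hα ht hs.1 (hy'.1.mono (Icc_subset_Icc_right hsT.2))),
    ← intervalIntegral.integral_const_mul]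
  refine intervalIntegral.norm_integral_le_of_norm_le hs.1 (ae_of_all _ fun r hr => ?_) ?_
  · exact h.f_lip _ _ _ (hα.2 r (ht.trans hr.1.le))
  · apply ContinuousOn.intervalIntegrable
    rw [uIcc_of_le hs.1]
    exact continuousOn_const.mul (hc.mono (Icc_subset_Icc_right hs.2))

theorem norm_traj_sub_traj_le (h : P.IsRegular M L C) (hα : α ∈ P.controls) (ht : t ∈ Icc 0 P.T)
    (hs : s ∈ Icc t P.T) (x x' : EuclideanSpace ℝ (Fin d)) :
    ‖P.traj x t α s - P.traj x' t α s‖ ≤ ‖x - x'‖ * Real.exp (L * P.T) := by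
  refine (h.norm_sub_le_of_isTrajectory hα ht.1 hs (fun _ _ => rfl) (h.isTrajectory_traj hα ht x)
    (h.isTrajectory_traj hα ht x') s ⟨hs.1, le_rfl⟩).trans ?_
  gcongr
  · exact h.L_pos.le
  · linarith [hs.2, ht.1]

/-- A trajectory up to time `σ` depends only on the control before `σ`. -/
theorem eqOn_of_isTrajectory (h : P.IsRegular M L C) (hα : α ∈ P.controls) (ht : 0 ≤ t)
    (hσ : σ ∈ Icc t P.T) (hαβ : EqOn α β (Ioo t σ)) (hy : P.IsTrajectory x t α y)
    (hy' : P.IsTrajectory x t β y') : EqOn y y' (Icc t σ) := by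
  intro s hs
  have := h.norm_sub_le_of_isTrajectory hα ht hσ hαβ hy hy' s hs
  rw [sub_self, norm_zero, zero_mul] at this
  exact sub_eq_zero.1 (norm_le_zero_iff.1 this)

theorem traj_congr (h : P.IsRegular M L C) (hα : α ∈ P.controls) (hβ : β ∈ P.controls)
    (ht : t ∈ Icc 0 P.T) (hσ : σ ∈ Icc t P.T) (hαβ : EqOn α β (Ioo t σ))
    (x : EuclideanSpace ℝ (Fin d)) : EqOn (P.traj x t α) (P.traj x t β) (Icc t σ) :=
  h.eqOn_of_isTrajectory hα ht.1 hσ hαβ (h.isTrajectory_traj hα ht x) (h.isTrajectory_traj hβ ht x)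

theorem traj_self (h : P.IsRegular M L C) (hα : α ∈ P.controls) (ht : t ∈ Icc 0 P.T)
    (x : EuclideanSpace ℝ (Fin d)) : P.traj x t α t = x := by
  have := ((h.isTrajectory_traj hα ht x).2 t ⟨le_rfl, ht.2⟩).2
  simpa using this

theorem continuousOn_traj (h : P.IsRegular M L C) (hα : α ∈ P.controls) (ht : t ∈ Icc 0 P.T)
    (x : EuclideanSpace ℝ (Fin d)) : ContinuousOn (P.traj x t α) (Icc t P.T) :=
  (h.isTrajectory_traj hα ht x).1

theorem traj_sub_eq_integral (h : P.IsRegular M L C) (hα : α ∈ P.controls) (ht : t ∈ Icc 0 P.T)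
    (hs : s ∈ Icc t P.T) (x : EuclideanSpace ℝ (Fin d)) :
    P.traj x t α s - x = ∫ r in t..s, P.f (P.traj x t α r) (α r) := by
  rw [((h.isTrajectory_traj hα ht x).2 s hs).2, add_sub_cancel_left]

theorem norm_traj_sub_le (h : P.IsRegular M L C) (hα : α ∈ P.controls) (ht : t ∈ Icc 0 P.T)
    (hs : s ∈ Icc t P.T) (x : EuclideanSpace ℝ (Fin d)) :
    ‖P.traj x t α s - x‖ ≤ M * (s - t) := by
  rw [h.traj_sub_eq_integral hα ht hs]
  have := intervalIntegral.norm_integral_le_of_norm_le_const (a := t) (b := s) (C := M)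
    (f := fun r => P.f (P.traj x t α r) (α r)) (fun r hr => by
      rw [uIoc_of_le hs.1] at hr
      exact h.f_le _ _ (hα.2 r (ht.1.trans hr.1.le)))
  rwa [abs_of_nonneg (sub_nonneg.2 hs.1)] at this

/-- The flow property: a trajectory restarted at time `σ` continues itself. -/
theorem traj_traj (h : P.IsRegular M L C) (hα : α ∈ P.controls) (hβ : β ∈ P.controls)
    (ht : t ∈ Icc 0 P.T) (hσ : σ ∈ Icc t P.T) (hαβ : EqOn α β (Ioo σ P.T))
    (x : EuclideanSpace ℝ (Fin d)) :
    EqOn (P.traj x t α) (P.traj (P.traj x t α σ) σ β) (Icc σ P.T) := by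
  have hσ0 : σ ∈ Icc 0 P.T := ⟨ht.1.trans hσ.1, hσ.2⟩
  have hy := h.isTrajectory_traj hα ht x
  refine h.eqOn_of_isTrajectory hα hσ0.1 ⟨hσ.2, le_rfl⟩ hαβ ?_ (h.isTrajectory_traj hβ hσ0 _)
  refine ⟨hy.1.mono (Icc_subset_Icc_left hσ.1), fun s hs => ?_⟩
  have h1 := hy.2 s ⟨hσ.1.trans hs.1, hs.2⟩
  have h2 := hy.2 σ hσ
  refine ⟨h2.1.symm.trans h1.1, ?_⟩
  rw [h1.2, h2.2, add_assoc, intervalIntegral.integral_add_adjacent_intervals h2.1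
    (h2.1.symm.trans h1.1)]

end IsRegular

/-- The control that follows `α` before time `σ` and `β` from `σ` on. -/
def concat (σ : ℝ) (α β : ℝ → EuclideanSpace ℝ (Fin m)) : ℝ → EuclideanSpace ℝ (Fin m) :=
  fun s => if s < σ then α s else β s

theorem concat_mem_controls (hα : α ∈ P.controls) (hβ : β ∈ P.controls) :
    concat σ α β ∈ P.controls := by
  refine ⟨?_, fun s hs => ?_⟩
  · exact Measurable.ite (p := fun s : Ici (0 : ℝ) => (s : ℝ) < σ)
      (measurable_subtype_coe measurableSet_Iio) hα.1 hβ.1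
  · unfold concat
    split_ifs
    exacts [hα.2 s hs, hβ.2 s hs]

theorem concat_eqOn_left : EqOn (concat σ α β) α (Iio σ) := fun _ hs => if_pos hs

theorem concat_eqOn_right : EqOn (concat σ α β) β (Ici σ) := fun _ hs => if_neg (not_lt.2 hs)

/-! ### The cost functional -/

/-- The discounted running cost accumulated between times `t` and `σ`. -/
def runCost (P : StoppingProblem d m) (x : EuclideanSpace ℝ (Fin d)) (t : ℝ)
    (α : ℝ → EuclideanSpace ℝ (Fin m)) (σ : ℝ) : ℝ :=
  ∫ s in t..σ, Real.exp (-P.lam * (s - t)) * P.ℓ (P.traj x t α s) (α s) s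

/-- The cost of following `α` until time `σ` and paying `W` there. For `W = ψ` this is `J`; for
`W = V` it is the right-hand side of the dynamic programming principle. -/
def cost (P : StoppingProblem d m) (W : EuclideanSpace ℝ (Fin d) → ℝ → ℝ)
    (x : EuclideanSpace ℝ (Fin d)) (t : ℝ) (α : ℝ → EuclideanSpace ℝ (Fin m)) (σ : ℝ) : ℝ :=
  P.runCost x t α σ + Real.exp (-P.lam * (σ - t)) * W (P.traj x t α σ) σ

theorem J_eq_cost : P.J x t α τ = P.cost P.ψ x t α τ := rfl

namespace IsRegular

theorem exp_le_one (h : P.IsRegular M L C) (hts : t ≤ s) : Real.exp (-P.lam * (s - t)) ≤ 1 := by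
  rw [Real.exp_le_one_iff, neg_mul, neg_nonpos]
  exact mul_nonneg h.lam_nonneg (sub_nonneg.2 hts)

theorem one_sub_le_exp (P : StoppingProblem d m) (t s : ℝ) :
    1 - P.lam * (s - t) ≤ Real.exp (-P.lam * (s - t)) := by
  linarith [Real.add_one_le_exp (-P.lam * (s - t))]

theorem intervalIntegrable_ℓ (h : P.IsRegular M L C) (hα : α ∈ P.controls) (ht : 0 ≤ t)
    (hts : t ≤ s) (hy : ContinuousOn y (Icc t s)) {θ : ℝ → ℝ} (hθ : ContinuousOn θ (Icc t s))
    (hmem : MapsTo θ (Icc t s) (Icc 0 P.T)) :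
    IntervalIntegrable (fun r => P.ℓ (y r) (α r) (θ r)) volume t s := by
  rw [intervalIntegrable_iff_integrableOn_Icc_of_le hts]
  have h1 : AEStronglyMeasurable (fun r => P.ℓ (y r) (α r) (θ r)) (volume.restrict (Icc t s)) :=
    h.ℓ_cont.aestronglyMeasurable_comp_of_mem (h := fun r => (y r, α r, θ r))
      (MeasurableSet.univ.prod (h.isCompact.measurableSet.prod measurableSet_Icc))
      measurableSet_Icc
      ((hy.aemeasurable measurableSet_Icc).prodMk
        ((aemeasurable_control hα ht).prodMk (hθ.aemeasurable measurableSet_Icc)))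
      (fun r hr => ⟨trivial, hα.2 r (ht.trans hr.1), hmem hr⟩)
  refine Integrable.of_bound h1 C ?_
  filter_upwards [ae_restrict_mem measurableSet_Icc] with r hr
  have hαr := hα.2 r (ht.trans hr.1)
  rw [Real.norm_of_nonneg (h.ℓ_nonneg _ _ hαr _ (hmem hr))]
  exact h.ℓ_le _ _ hαr _ (hmem hr)

theorem intervalIntegrable_runCost (h : P.IsRegular M L C) (hα : α ∈ P.controls)
    (ht : t ∈ Icc 0 P.T) (hs : s ∈ Icc t P.T) (x : EuclideanSpace ℝ (Fin d)) :
    IntervalIntegrable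
      (fun r => Real.exp (-P.lam * (r - t)) * P.ℓ (P.traj x t α r) (α r) r) volume t s :=
  (h.intervalIntegrable_ℓ hα ht.1 hs.1 ((h.continuousOn_traj hα ht x).mono
    (Icc_subset_Icc_right hs.2)) continuousOn_id
    (fun _ hr => ⟨ht.1.trans hr.1, hr.2.trans hs.2⟩)).continuousOn_mul (by fun_prop)

theorem runCost_nonneg (h : P.IsRegular M L C) (hα : α ∈ P.controls) (ht : t ∈ Icc 0 P.T)
    (hs : s ∈ Icc t P.T) : 0 ≤ P.runCost x t α s :=
  intervalIntegral.integral_nonneg hs.1 fun r hr => mul_nonneg (Real.exp_pos _).le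
    (h.ℓ_nonneg _ _ (hα.2 r (ht.1.trans hr.1)) _ ⟨ht.1.trans hr.1, hr.2.trans hs.2⟩)

theorem runCost_le (h : P.IsRegular M L C) (hα : α ∈ P.controls) (ht : t ∈ Icc 0 P.T)
    (hs : s ∈ Icc t P.T) : P.runCost x t α s ≤ C * (s - t) := by
  have := intervalIntegral.norm_integral_le_of_norm_le_const (a := t) (b := s) (C := C)
    (f := fun r => Real.exp (-P.lam * (r - t)) * P.ℓ (P.traj x t α r) (α r) r) (fun r hr => by
      rw [uIoc_of_le hs.1] at hr
      have hr0 : r ∈ Icc 0 P.T := ⟨ht.1.trans hr.1.le, hr.2.trans hs.2⟩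
      have h0 := h.ℓ_nonneg (P.traj x t α r) _ (hα.2 r hr0.1) _ hr0
      rw [Real.norm_of_nonneg (mul_nonneg (Real.exp_pos _).le h0)]
      exact (mul_le_of_le_one_left h0 (h.exp_le_one hr.1.le)).trans
        (h.ℓ_le _ _ (hα.2 r hr0.1) _ hr0))
  rw [abs_of_nonneg (sub_nonneg.2 hs.1)] at this
  exact (le_abs_self _).trans this

theorem runCost_congr (h : P.IsRegular M L C) (hα : α ∈ P.controls) (hβ : β ∈ P.controls)
    (ht : t ∈ Icc 0 P.T) (hσ : σ ∈ Icc t P.T) (hαβ : EqOn α β (Ioo t σ)) :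
    P.runCost x t α σ = P.runCost x t β σ :=
  intervalIntegral.integral_congr_Ioo_of_le hσ.1 fun r hr => by
    simp only [hαβ hr, h.traj_congr hα hβ ht hσ hαβ x ⟨hr.1.le, hr.2.le⟩]

theorem cost_congr (h : P.IsRegular M L C) (hα : α ∈ P.controls) (hβ : β ∈ P.controls)
    (ht : t ∈ Icc 0 P.T) (hσ : σ ∈ Icc t P.T) (hαβ : EqOn α β (Ioo t σ))
    (W : EuclideanSpace ℝ (Fin d) → ℝ → ℝ) : P.cost W x t α σ = P.cost W x t β σ := by
  rw [cost, cost, h.runCost_congr hα hβ ht hσ hαβ, h.traj_congr hα hβ ht hσ hαβ x ⟨hσ.1, le_rfl⟩]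

theorem cost_split (h : P.IsRegular M L C) (hα : α ∈ P.controls) (hβ : β ∈ P.controls)
    (ht : t ∈ Icc 0 P.T) (hσ : σ ∈ Icc t P.T) (hτ : τ ∈ Icc σ P.T) (hαβ : EqOn α β (Ioo σ P.T))
    (W : EuclideanSpace ℝ (Fin d) → ℝ → ℝ) (x : EuclideanSpace ℝ (Fin d)) :
    P.cost W x t α τ =
      P.cost (fun z r => P.cost W z r β τ) x t α σ := by
  have hT := h.traj_traj hα hβ ht hσ hαβ x
  have hI1 := h.intervalIntegrable_runCost hα ht hσ x
  have hI2 := h.intervalIntegrable_runCost hα ht ⟨hσ.1.trans hτ.1, hτ.2⟩ x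
  have e1 : P.runCost x t α τ = P.runCost x t α σ +
      Real.exp (-P.lam * (σ - t)) * P.runCost (P.traj x t α σ) σ β τ := by
    rw [runCost, runCost, runCost,
      ← intervalIntegral.integral_add_adjacent_intervals hI1 (hI1.symm.trans hI2),
      ← intervalIntegral.integral_const_mul]
    congr 1
    refine intervalIntegral.integral_congr_Ioo_of_le hτ.1 fun r hr => ?_
    rw [← hT ⟨hr.1.le, hr.2.le.trans hτ.2⟩, hαβ ⟨hr.1, hr.2.trans_le hτ.2⟩, ← mul_assoc,
      ← Real.exp_add]
    ring_nf
  have e2 : Real.exp (-P.lam * (τ - t)) =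
      Real.exp (-P.lam * (σ - t)) * Real.exp (-P.lam * (τ - σ)) := by
    rw [← Real.exp_add]; ring_nf
  simp only [cost]
  rw [e1, e2, hT hτ]
  ring

theorem J_nonneg (h : P.IsRegular M L C) (hα : α ∈ P.controls) (ht : t ∈ Icc 0 P.T)
    (hτ : τ ∈ Icc t P.T) : 0 ≤ P.J x t α τ :=
  add_nonneg (h.runCost_nonneg hα ht hτ)
    (mul_nonneg (Real.exp_pos _).le (h.ψ_nonneg _ _ ⟨ht.1.trans hτ.1, hτ.2⟩))

theorem cost_self (h : P.IsRegular M L C) (hα : α ∈ P.controls) (ht : t ∈ Icc 0 P.T)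
    (W : EuclideanSpace ℝ (Fin d) → ℝ → ℝ) : P.cost W x t α t = W x t := by
  simp [cost, runCost, h.traj_self hα ht]

/-- The cost depends on the initial state uniformly continuously, uniformly in the initial time,
the control and the stopping time. -/
theorem abs_J_sub_J_le (h : P.IsRegular M L C) {ε : ℝ} (hε : 0 < ε) : ∃ δ > 0,
    ∀ x x' : EuclideanSpace ℝ (Fin d), ‖x - x'‖ < δ → ∀ t ∈ Icc 0 P.T, ∀ α ∈ P.controls,
      ∀ τ ∈ Icc t P.T, |P.J x t α τ - P.J x' t α τ| ≤ ε := by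
  have hT := h.T_pos
  obtain ⟨δ₁, hδ₁, h1⟩ := h.ℓ_unif (ε / (2 * P.T)) (by positivity)
  obtain ⟨δ₂, hδ₂, h2⟩ := Metric.uniformContinuousOn_iff.1 h.ψ_cont (ε / 2) (by positivity)
  have hE := Real.exp_pos (L * P.T)
  refine ⟨min δ₁ δ₂ / Real.exp (L * P.T), by positivity, fun x x' hxx t ht α hα τ hτ => ?_⟩
  rw [lt_div_iff₀ hE] at hxx
  have hd : ∀ s ∈ Icc t P.T, ‖P.traj x t α s - P.traj x' t α s‖ < min δ₁ δ₂ := fun s hs =>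
    (h.norm_traj_sub_traj_le hα ht hs x x').trans_lt hxx
  have hτ0 : τ ∈ Icc 0 P.T := ⟨ht.1.trans hτ.1, hτ.2⟩
  have hrun : |P.runCost x t α τ - P.runCost x' t α τ| ≤ ε / 2 := by
    rw [runCost, runCost, ← intervalIntegral.integral_sub (h.intervalIntegrable_runCost hα ht hτ x)
      (h.intervalIntegrable_runCost hα ht hτ x')]
    have := intervalIntegral.norm_integral_le_of_norm_le_const (a := t) (b := τ)
      (C := ε / (2 * P.T))
      (f := fun r => Real.exp (-P.lam * (r - t)) * P.ℓ (P.traj x t α r) (α r) r -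
        Real.exp (-P.lam * (r - t)) * P.ℓ (P.traj x' t α r) (α r) r) (fun r hr => by
        rw [uIoc_of_le hτ.1] at hr
        have hr0 : r ∈ Icc t P.T := ⟨hr.1.le, hr.2.trans hτ.2⟩
        rw [← mul_sub, norm_mul, Real.norm_of_nonneg (Real.exp_pos _).le]
        refine (mul_le_of_le_one_left (norm_nonneg _) (h.exp_le_one hr.1.le)).trans ?_
        exact (h1 _ _ _ (hα.2 r (ht.1.trans hr0.1)) _ ⟨ht.1.trans hr0.1, hr0.2⟩
          ((hd r hr0).trans_le (min_le_left _ _))).le)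
    refine this.trans ?_
    rw [abs_of_nonneg (sub_nonneg.2 hτ.1), div_mul_eq_mul_div, div_le_div_iff₀ (by positivity)
      (by positivity)]
    have : τ - t ≤ P.T := by linarith [hτ.2, ht.1]
    nlinarith
  have hfin : |Real.exp (-P.lam * (τ - t)) * P.ψ (P.traj x t α τ) τ -
      Real.exp (-P.lam * (τ - t)) * P.ψ (P.traj x' t α τ) τ| ≤ ε / 2 := by
    rw [← mul_sub, abs_mul, abs_of_pos (Real.exp_pos _)]
    refine (mul_le_of_le_one_left (abs_nonneg _) (h.exp_le_one hτ.1)).trans ?_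
    have := h2 (P.traj x t α τ, τ) ⟨trivial, hτ0⟩ (P.traj x' t α τ, τ) ⟨trivial, hτ0⟩ (by
      rw [Prod.dist_eq, dist_self, max_eq_left dist_nonneg, dist_eq_norm]
      exact (hd τ hτ).trans_le (min_le_right _ _))
    exact this.le
  rw [J_eq_cost, J_eq_cost, cost, cost, add_sub_add_comm]
  exact (abs_add_le _ _).trans (by linarith)

/-! ### The value function and dynamic programming -/

theorem bddBelow_J (h : P.IsRegular M L C) (ht : t ∈ Icc 0 P.T) :
    BddBelow (range fun q : P.controls × Icc t P.T => P.J x t q.1 q.2) :=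
  ⟨0, by rintro _ ⟨q, rfl⟩; exact h.J_nonneg q.1.2 ht q.2.2⟩

theorem nonempty_controls (h : P.IsRegular M L C) : Nonempty P.controls :=
  let ⟨_, ha⟩ := h.nonempty
  ⟨⟨_, const_mem_controls ha⟩⟩

theorem V_le_J (h : P.IsRegular M L C) (hα : α ∈ P.controls) (ht : t ∈ Icc 0 P.T)
    (hτ : τ ∈ Icc t P.T) : P.V x t ≤ P.J x t α τ :=
  ciInf_le (h.bddBelow_J ht) (⟨α, hα⟩, ⟨τ, hτ⟩)

theorem le_V (h : P.IsRegular M L C) (ht : t ∈ Icc 0 P.T) {c : ℝ}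
    (hc : ∀ α ∈ P.controls, ∀ τ ∈ Icc t P.T, c ≤ P.J x t α τ) : c ≤ P.V x t := by
  have : Nonempty P.controls := h.nonempty_controls
  have : Nonempty (Icc t P.T) := ⟨⟨t, le_rfl, ht.2⟩⟩
  exact le_ciInf fun q => hc q.1 q.1.2 q.2 q.2.2

theorem exists_J_lt (h : P.IsRegular M L C) (ht : t ∈ Icc 0 P.T) {ε : ℝ} (hε : 0 < ε)
    (x : EuclideanSpace ℝ (Fin d)) :
    ∃ α ∈ P.controls, ∃ τ ∈ Icc t P.T, P.J x t α τ < P.V x t + ε := by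
  by_contra! hcon
  linarith [h.le_V ht hcon]

theorem V_nonneg (h : P.IsRegular M L C) (ht : t ∈ Icc 0 P.T) : 0 ≤ P.V x t :=
  h.le_V ht fun _ hα _ hτ => h.J_nonneg hα ht hτ

theorem V_le_ψ (h : P.IsRegular M L C) (ht : t ∈ Icc 0 P.T) : P.V x t ≤ P.ψ x t := by
  obtain ⟨⟨α, hα⟩⟩ := h.nonempty_controls
  have := h.V_le_J hα ht (x := x) ⟨le_rfl, ht.2⟩
  rwa [J_eq_cost, h.cost_self hα ht] at this

theorem V_le (h : P.IsRegular M L C) (ht : t ∈ Icc 0 P.T) : P.V x t ≤ C :=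
  (h.V_le_ψ ht).trans (h.ψ_le _ _ ht)

theorem V_terminal (h : P.IsRegular M L C) (x : EuclideanSpace ℝ (Fin d)) :
    P.V x P.T = P.ψ x P.T := by
  have hT : P.T ∈ Icc 0 P.T := ⟨h.T_pos.le, le_rfl⟩
  refine le_antisymm (h.V_le_ψ hT) (h.le_V hT fun α hα τ hτ => ?_)
  rw [le_antisymm hτ.2 hτ.1, J_eq_cost, h.cost_self hα hT]

theorem cost_mono {W W' : EuclideanSpace ℝ (Fin d) → ℝ → ℝ}
    (hW : W (P.traj x t α σ) σ ≤ W' (P.traj x t α σ) σ) :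
    P.cost W x t α σ ≤ P.cost W' x t α σ :=
  add_le_add_right (mul_le_mul_of_nonneg_left hW (Real.exp_pos _).le) _

/-- Before the stopping time, the cost dominates the right-hand side of the dynamic programming
principle. -/
theorem cost_V_le_J (h : P.IsRegular M L C) (hα : α ∈ P.controls) (ht : t ∈ Icc 0 P.T)
    (hσ : σ ∈ Icc t P.T) (hτ : τ ∈ Icc σ P.T) : P.cost P.V x t α σ ≤ P.J x t α τ := by
  rw [J_eq_cost, h.cost_split hα hα ht hσ hτ (fun _ _ => rfl)]
  exact cost_mono (h.V_le_J hα ⟨ht.1.trans hσ.1, hσ.2⟩ hτ)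

/-- One half of the dynamic programming principle: follow `α` until time `σ` and continue with
an almost optimal control and stopping time. -/
theorem V_le_cost_V (h : P.IsRegular M L C) (hα : α ∈ P.controls) (ht : t ∈ Icc 0 P.T)
    (hσ : σ ∈ Icc t P.T) : P.V x t ≤ P.cost P.V x t α σ := by
  have hσ0 : σ ∈ Icc 0 P.T := ⟨ht.1.trans hσ.1, hσ.2⟩
  refine le_of_forall_pos_le_add fun ε hε => ?_
  obtain ⟨β, hβ, τ, hτ, hJ⟩ := h.exists_J_lt hσ0 hε (P.traj x t α σ)
  have hγ : concat σ α β ∈ P.controls := concat_mem_controls hα hβ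
  have hγα : EqOn (concat σ α β) α (Ioo t σ) := concat_eqOn_left.mono fun r hr => hr.2
  have hγβ : EqOn (concat σ α β) β (Ioo σ P.T) := concat_eqOn_right.mono fun r hr => hr.1.le
  have h1 := h.V_le_J (x := x) hγ ht ⟨hσ.1.trans hτ.1, hτ.2⟩
  rw [J_eq_cost, h.cost_split hγ hβ ht hσ hτ hγβ, h.cost_congr hγ hα ht hσ hγα] at h1
  refine h1.trans ?_
  rw [J_eq_cost] at hJ
  have he := h.exp_le_one hσ.1
  have := mul_le_mul_of_nonneg_left hJ.le (Real.exp_pos (-P.lam * (σ - t))).le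
  simp only [cost] at this ⊢
  nlinarith

/-! ### Regularity of the value function -/

theorem abs_V_sub_V_le (h : P.IsRegular M L C) {ε : ℝ} (hε : 0 < ε) : ∃ δ > 0,
    ∀ x x' : EuclideanSpace ℝ (Fin d), ‖x - x'‖ < δ → ∀ t ∈ Icc 0 P.T,
      |P.V x t - P.V x' t| ≤ ε := by
  obtain ⟨δ, hδ, hJ⟩ := h.abs_J_sub_J_le hε
  have key : ∀ x x' : EuclideanSpace ℝ (Fin d), ‖x - x'‖ < δ → ∀ t ∈ Icc 0 P.T,
      P.V x t - ε ≤ P.V x' t := fun x x' hxx t ht =>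
    h.le_V ht fun α hα τ hτ => by
      linarith [(abs_le.1 (hJ x x' hxx t ht α hα τ hτ)).2, h.V_le_J (x := x) hα ht hτ]
  refine ⟨δ, hδ, fun x x' hxx t ht => abs_le.2 ⟨?_, ?_⟩⟩
  · linarith [key x' x (by rwa [norm_sub_rev]) t ht]
  · linarith [key x x' hxx t ht]

/-- Continuity in time comes from dynamic programming: in the time `t' - t` the state moves by at
most `M * (t' - t)` and little cost is accumulated. -/
theorem isBUC_V (h : P.IsRegular M L C) : P.IsBUC P.V := by
  refine ⟨⟨C, fun x t ht => by rw [abs_of_nonneg (h.V_nonneg ht)]; exact h.V_le ht⟩, ?_⟩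
  rw [Metric.uniformContinuousOn_iff]
  intro ε hε
  obtain ⟨δ₁, hδ₁, hV⟩ := h.abs_V_sub_V_le (show 0 < ε / 8 by positivity)
  obtain ⟨δ₂, hδ₂, hψ⟩ := Metric.uniformContinuousOn_iff.1 h.ψ_cont (ε / 8) (by positivity)
  have hM := h.M_nonneg
  have hC := h.C_nonneg
  have hl := h.lam_nonneg
  -- `K` dominates every constant that multiplies `t' - t` below
  set K : ℝ := C * P.lam + C + M + 1 with hK
  have hK1 : 1 ≤ K := by have := mul_nonneg hC hl; linarith
  have hKC : C ≤ K := by have := mul_nonneg hC hl; linarith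
  have hKM : M ≤ K := by have := mul_nonneg hC hl; linarith
  have hKl : C * P.lam ≤ K := by linarith
  set δ := min (min δ₁ δ₂) (ε / 8) / K with hδ
  have hδ0 : 0 < δ := by positivity
  have time : ∀ x, ∀ t ∈ Icc 0 P.T, ∀ t' ∈ Icc t P.T, t' - t < δ → |P.V x t - P.V x t'| ≤ ε / 2 := by
    intro x t ht t' ht' htt
    have ht'0 : t' ∈ Icc 0 P.T := ⟨ht.1.trans ht'.1, ht'.2⟩
    have hh : 0 ≤ t' - t := sub_nonneg.2 ht'.1
    have hKh : K * (t' - t) < min (min δ₁ δ₂) (ε / 8) := by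
      rw [hδ, lt_div_iff₀ (by linarith)] at htt
      linarith
    have hb1 : K * (t' - t) < δ₁ := hKh.trans_le ((min_le_left _ _).trans (min_le_left _ _))
    have hb2 : K * (t' - t) < δ₂ := hKh.trans_le ((min_le_left _ _).trans (min_le_right _ _))
    have hb3 : K * (t' - t) < ε / 8 := hKh.trans_le (min_le_right _ _)
    have hCh : C * (t' - t) ≤ K * (t' - t) := mul_le_mul_of_nonneg_right hKC hh
    have hMh : M * (t' - t) ≤ K * (t' - t) := mul_le_mul_of_nonneg_right hKM hh
    have h1h : t' - t ≤ K * (t' - t) := le_mul_of_one_le_left hh hK1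
    have hlh : C * P.lam * (t' - t) ≤ K * (t' - t) := mul_le_mul_of_nonneg_right hKl hh
    have space : ∀ α ∈ P.controls, |P.V (P.traj x t α t') t' - P.V x t'| ≤ ε / 8 := fun α hα =>
      hV _ _ (((h.norm_traj_sub_le hα ht ht' x).trans hMh).trans_lt hb1) t' ht'0
    rw [abs_le]
    constructor
    · suffices P.V x t' - ε / 2 ≤ P.V x t by linarith
      refine h.le_V ht fun α hα τ hτ => ?_
      -- stopping before `t'` is compared with stopping at `t'` at once
      rcases le_total t' τ with hle | hle
      · have h1 := h.cost_V_le_J (x := x) hα ht ht' ⟨hle, hτ.2⟩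
        have h2 := h.runCost_nonneg (x := x) hα ht ht'
        have h3 := one_sub_le_exp P t t'
        have h4 := (abs_le.1 (space α hα)).1
        have h5 := h.V_nonneg (x := P.traj x t α t') ht'0
        have h6 := h.V_le (x := P.traj x t α t') ht'0
        have h7 := mul_le_mul_of_nonneg_right h3 h5
        have h8 : P.lam * (t' - t) * P.V (P.traj x t α t') t' ≤ P.lam * (t' - t) * C :=
          mul_le_mul_of_nonneg_left h6 (mul_nonneg hl hh)
        simp only [cost] at h1
        nlinarith
      · have hτ0 : τ ∈ Icc 0 P.T := ⟨ht.1.trans hτ.1, hτ.2⟩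
        have hτh : τ - t ≤ t' - t := by linarith
        have hτh0 : 0 ≤ τ - t := sub_nonneg.2 hτ.1
        have h1 := h.runCost_nonneg (x := x) hα ht hτ
        have h2 := one_sub_le_exp P t τ
        have h3 := h.ψ_nonneg (P.traj x t α τ) τ hτ0
        have h4 := h.ψ_le (P.traj x t α τ) τ hτ0
        have h5 := hψ (P.traj x t α τ, τ) ⟨trivial, hτ0⟩ (x, t') ⟨trivial, ht'0⟩ (by
          rw [Prod.dist_eq, max_lt_iff]
          constructor
          · rw [dist_eq_norm]
            refine (h.norm_traj_sub_le hα ht hτ x).trans_lt ?_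
            exact ((mul_le_mul_of_nonneg_left hτh hM).trans hMh).trans_lt hb2
          · rw [dist_comm, Real.dist_eq, abs_of_nonneg (by linarith)]
            simp only
            linarith)
        rw [Real.dist_eq] at h5
        have h6 := (abs_lt.1 h5).1
        have h7 := h.V_le_ψ (x := x) ht'0
        have h8 := mul_le_mul_of_nonneg_right h2 h3
        have h9 : P.lam * (τ - t) * P.ψ (P.traj x t α τ) τ ≤ P.lam * (t' - t) * C :=
          mul_le_mul (mul_le_mul_of_nonneg_left hτh hl) h4 h3 (mul_nonneg hl hh)
        rw [J_eq_cost, cost]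
        simp only at h6
        nlinarith
    · obtain ⟨⟨α, hα⟩⟩ := h.nonempty_controls
      have h1 := h.V_le_cost_V (x := x) hα ht ht'
      have h2 := h.runCost_le (x := x) hα ht ht'
      have h3 := mul_le_of_le_one_left (h.V_nonneg (x := P.traj x t α t') ht'0)
        (h.exp_le_one ht'.1)
      have h4 := (abs_le.1 (space α hα)).2
      rw [cost] at h1
      linarith
  refine ⟨min δ δ₁, lt_min hδ0 hδ₁, ?_⟩
  rintro ⟨x, t⟩ ⟨-, ht⟩ ⟨x', t'⟩ ⟨-, ht'⟩ hd
  simp only at ht ht'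
  rw [Prod.dist_eq, max_lt_iff] at hd
  have h1 := hV x x' (by rw [← dist_eq_norm]; exact hd.1.trans_le (min_le_right _ _)) t ht
  have hdt : dist t t' < δ := hd.2.trans_le (min_le_left _ _)
  have h2 : |P.V x' t - P.V x' t'| ≤ ε / 2 := by
    rw [Real.dist_eq] at hdt
    rcases le_total t t' with hle | hle
    · exact time x' t ht t' ⟨hle, ht'.2⟩ (by linarith [(abs_lt.1 hdt).1])
    · rw [abs_sub_comm]
      exact time x' t' ht' t ⟨hle, ht.2⟩ (by linarith [(abs_lt.1 hdt).2])
  rw [Real.dist_eq]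
  have h3 := abs_sub_le (P.V x t) (P.V x' t) (P.V x' t')
  simp only
  linarith

end IsRegular
end StoppingProblem

/-! ### The value function is a viscosity solution -/

/-- The derivative of a function of state and time in terms of its gradient in the state and its
derivative in time. -/
theorem fderiv_prod_apply_eq_inner_gradient_add {E : Type*} [NormedAddCommGroup E]
    [InnerProductSpace ℝ E] [CompleteSpace E] {φ : E × ℝ → ℝ} {x : E} {t : ℝ}
    (hφ : DifferentiableAt ℝ φ (x, t)) (v : E) (k : ℝ) :
    fderiv ℝ φ (x, t) (v, k) =
      inner ℝ v (gradient (fun z => φ (z, t)) x) + k * deriv (fun s => φ (x, s)) t := by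
  have h1 : HasFDerivAt (fun z => φ (z, t)) _ x :=
    hφ.hasFDerivAt.comp x (hasFDerivAt_prodMk_left x t)
  have h2 : HasFDerivAt (fun s => φ (x, s)) _ t :=
    hφ.hasFDerivAt.comp t (hasFDerivAt_prodMk_right x t)
  have e : ((v, k) : E × ℝ) = (v, 0) + (0, k) := by simp
  rw [real_inner_comm, inner_gradient_left, h1.fderiv, h2.hasDerivAt.deriv, e, map_add]
  congr 1
  have e2 : ((0, k) : E × ℝ) = k • (0, 1) := by simp
  rw [e2, map_smul]
  simp

namespace StoppingProblem
variable {d m : ℕ} {P : StoppingProblem d m} {M L C : ℝ}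
  {x x' : EuclideanSpace ℝ (Fin d)} {t s τ σ : ℝ} {α β : ℝ → EuclideanSpace ℝ (Fin m)}

namespace IsRegular

theorem bddAbove_hamiltonian (h : P.IsRegular M L C) (ht : t ∈ Icc 0 P.T)
    (x ξ : EuclideanSpace ℝ (Fin d)) :
    BddAbove (range fun a : P.A => -inner ℝ (P.f x a) ξ - P.ℓ x a t) := by
  refine ⟨M * ‖ξ‖, ?_⟩
  rintro _ ⟨a, rfl⟩
  have h1 := (abs_le.1 (abs_real_inner_le_norm (P.f x a) ξ)).1
  have h2 := mul_le_mul_of_nonneg_right (h.f_le x a a.2) (norm_nonneg ξ)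
  have h3 := h.ℓ_nonneg x a a.2 t ht
  simp only
  linarith

theorem le_H (h : P.IsRegular M L C) (ht : t ∈ Icc 0 P.T) {a : EuclideanSpace ℝ (Fin m)}
    (ha : a ∈ P.A) (x ξ : EuclideanSpace ℝ (Fin d)) :
    -inner ℝ (P.f x a) ξ - P.ℓ x a t ≤ P.H x t ξ :=
  le_ciSup (h.bddAbove_hamiltonian ht x ξ) ⟨a, ha⟩

theorem H_le (h : P.IsRegular M L C) {ξ : EuclideanSpace ℝ (Fin d)} {c : ℝ}
    (hc : ∀ a ∈ P.A, -inner ℝ (P.f x a) ξ - P.ℓ x a t ≤ c) : P.H x t ξ ≤ c := by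
  have : Nonempty P.A := h.nonempty.to_subtype
  exact ciSup_le fun a => hc a a.2

/-- On bounded sets of states the running cost is uniformly continuous in state and time,
uniformly in the control. -/
theorem ℓ_uniform_on_ball (h : P.IsRegular M L C) (R : ℝ) {ε : ℝ} (hε : 0 < ε) : ∃ δ > 0,
    ∀ x x' : EuclideanSpace ℝ (Fin d), ‖x‖ ≤ R → ‖x'‖ ≤ R → ‖x - x'‖ < δ →
      ∀ s ∈ Icc 0 P.T, ∀ s' ∈ Icc 0 P.T, |s - s'| < δ → ∀ a ∈ P.A,
        |P.ℓ x a s - P.ℓ x' a s'| < ε := by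
  have hK : IsCompact (Metric.closedBall (0 : EuclideanSpace ℝ (Fin d)) R ×ˢ
      P.A ×ˢ Icc 0 P.T) :=
    (isCompact_closedBall _ _).prod (h.isCompact.prod isCompact_Icc)
  have hu := hK.uniformContinuousOn_of_continuous
    (h.ℓ_cont.mono (prod_mono (subset_univ _) le_rfl))
  obtain ⟨δ, hδ, hu⟩ := Metric.uniformContinuousOn_iff.1 hu ε hε
  refine ⟨δ, hδ, fun x x' hx hx' hxx s hs s' hs' hss a ha => ?_⟩
  refine hu (x, a, s) ⟨by simpa using hx, ha, hs⟩ (x', a, s') ⟨by simpa using hx', ha, hs'⟩ ?_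
  rw [Prod.dist_eq, Prod.dist_eq, dist_self, dist_eq_norm, Real.dist_eq]
  simp [hxx, hss]

end IsRegular

theorem eventually_mul_lt (c : ℝ) {δ : ℝ} (hδ : 0 < δ) : ∀ᶠ k in 𝓝[>] (0 : ℝ), c * k < δ := by
  have : Tendsto (fun k : ℝ => c * k) (𝓝 0) (𝓝 (c * 0)) := (continuous_const_mul c).tendsto 0
  rw [mul_zero] at this
  exact (this.mono_left nhdsWithin_le_nhds).eventually_lt_const hδ

namespace IsRegular

/-- Trajectories started at `(x, t)` stay close to `(x, t)` for short times, uniformly in the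
control. -/
theorem eventually_dist_traj_lt (h : P.IsRegular M L C) (ht : t ∈ Ico 0 P.T) {δ : ℝ}
    (hδ : 0 < δ) (x : EuclideanSpace ℝ (Fin d)) : ∀ᶠ k in 𝓝[>] (0 : ℝ), t + k < P.T ∧
      ∀ α ∈ P.controls, ∀ s ∈ Icc t (t + k), dist (P.traj x t α s, s) (x, t) < δ := by
  have hM := h.M_nonneg
  filter_upwards [eventually_mul_lt 1 (sub_pos.2 ht.2), eventually_mul_lt (M + 1) hδ,
    self_mem_nhdsWithin] with k hk1 hk2 hk0
  have hkT : t + k < P.T := by linarith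
  refine ⟨hkT, fun α hα s hs => ?_⟩
  have hst : s - t ≤ k := by linarith [hs.2]
  have hst0 : 0 ≤ s - t := sub_nonneg.2 hs.1
  have h0 : 0 < k := hk0
  rw [Prod.dist_eq, max_lt_iff, dist_eq_norm, Real.dist_eq, abs_of_nonneg hst0]
  constructor
  · refine (h.norm_traj_sub_le hα ⟨ht.1, ht.2.le⟩ ⟨hs.1, hs.2.trans hkT.le⟩ x).trans_lt ?_
    nlinarith
  · nlinarith

theorem intervalIntegrable_inner_f (h : P.IsRegular M L C) (hα : α ∈ P.controls) (ht : 0 ≤ t)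
    (hts : t ≤ s) (x ξ : EuclideanSpace ℝ (Fin d)) :
    IntervalIntegrable (fun r => inner ℝ (P.f x (α r)) ξ) volume t s := by
  have hI := h.intervalIntegrable_f (y := fun _ => x) hα ht hts continuousOn_const
  simp_rw [real_inner_comm ξ]
  exact ⟨(innerSL ℝ ξ).integrable_comp hI.1, (innerSL ℝ ξ).integrable_comp hI.2⟩

/-- First-order expansion of a test function along trajectories, uniformly in the control. Only
the differentiability of `φ` at the starting point and the bound on the speed of trajectories are
used, so no chain rule along the merely absolutely continuous trajectories is needed. -/
theorem eventually_abs_expansion_le (h : P.IsRegular M L C) (ht : t ∈ Ico 0 P.T)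
    {φ : EuclideanSpace ℝ (Fin d) × ℝ → ℝ} {D : EuclideanSpace ℝ (Fin d) × ℝ →L[ℝ] ℝ}
    {ξ : EuclideanSpace ℝ (Fin d)} {q : ℝ} (hφ : HasFDerivAt φ D (x, t))
    (hD : ∀ v k, D (v, k) = inner ℝ v ξ + k * q) {η : ℝ} (hη : 0 < η) :
    ∀ᶠ k in 𝓝[>] (0 : ℝ), ∀ α ∈ P.controls,
      |φ (P.traj x t α (t + k), t + k) - φ (x, t) + P.runCost x t α (t + k) -
        ∫ r in t..t + k, (q + inner ℝ (P.f x (α r)) ξ + P.ℓ x (α r) t)| ≤ η * k := by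
  have hM := h.M_nonneg
  have hL := h.L_pos
  have ht' : t ∈ Icc 0 P.T := ⟨ht.1, ht.2.le⟩
  obtain ⟨δ₁, hδ₁, hφ'⟩ := Metric.eventually_nhds_iff.1
    (hφ.isLittleO.def (show 0 < η / (4 * (M + 1)) by positivity))
  obtain ⟨δ₂, hδ₂, hℓ⟩ := h.ℓ_uniform_on_ball (‖x‖ + 1) (show 0 < η / 4 by positivity)
  filter_upwards [h.eventually_dist_traj_lt ht hδ₁ x, h.eventually_dist_traj_lt ht hδ₂ x,
    h.eventually_dist_traj_lt ht one_pos x, eventually_mul_lt (‖ξ‖ * L * M)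
      (show 0 < η / 4 by positivity), eventually_mul_lt (P.lam * C)
      (show 0 < η / 4 by positivity), self_mem_nhdsWithin] with k hk1 hk2 hk3 hk4 hk5 hk0 α hα
  have hk : 0 < k := hk0
  have hs : t + k ∈ Icc t P.T := ⟨by linarith, hk1.1.le⟩
  have hend : t + k ∈ Icc t (t + k) := ⟨by linarith, le_rfl⟩
  set y := P.traj x t α with hy
  have hyc : ContinuousOn y (Icc t (t + k)) :=
    (h.continuousOn_traj hα ht' x).mono (Icc_subset_Icc_right hs.2)
  have hI1 : IntervalIntegrable (fun r => P.f x (α r)) volume t (t + k) :=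
    h.intervalIntegrable_f hα ht.1 hs.1 continuousOn_const
  have hI2 : IntervalIntegrable (fun r => P.f (y r) (α r)) volume t (t + k) :=
    h.intervalIntegrable_f hα ht.1 hs.1 hyc
  have hI3 : IntervalIntegrable (fun r => P.ℓ x (α r) t) volume t (t + k) :=
    h.intervalIntegrable_ℓ hα ht.1 hs.1 continuousOn_const continuousOn_const fun _ _ => ht'
  have hI4 := h.intervalIntegrable_runCost hα ht' hs x
  have hI1' := h.intervalIntegrable_inner_f hα ht.1 hs.1 x ξ
  have hA : |φ (y (t + k), t + k) - φ (x, t) - D (y (t + k) - x, k)| ≤ η / 4 * k := by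
    have h1 := hφ' (hk1.2 α hα _ hend)
    have e : (y (t + k), t + k) - (x, t) = (y (t + k) - x, k) := by simp
    rw [e, Real.norm_eq_abs] at h1
    refine h1.trans ?_
    have h2 : ‖(y (t + k) - x, k)‖ ≤ (M + 1) * k := by
      rw [Prod.norm_def, Real.norm_of_nonneg hk.le]
      refine max_le ?_ (by nlinarith)
      have := h.norm_traj_sub_le hα ht' hs x
      rw [add_sub_cancel_left] at this
      exact this.trans (by nlinarith)
    refine (mul_le_mul_of_nonneg_left h2 (by positivity)).trans (le_of_eq ?_)
    field_simp
  have hB : |inner ℝ (y (t + k) - x) ξ - ∫ r in t..t + k, inner ℝ (P.f x (α r)) ξ| ≤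
      η / 4 * k := by
    have e : inner ℝ (y (t + k) - x) ξ - ∫ r in t..t + k, inner ℝ (P.f x (α r)) ξ =
        ∫ r in t..t + k, innerSL ℝ ξ (P.f (y r) (α r) - P.f x (α r)) := by
      rw [(innerSL ℝ ξ).intervalIntegral_comp_comm (hI2.sub hI1),
        intervalIntegral.integral_sub hI2 hI1, map_sub,
        ← (innerSL ℝ ξ).intervalIntegral_comp_comm hI1, h.traj_sub_eq_integral hα ht' hs]
      simp only [innerSL_apply_apply, real_inner_comm ξ]
      rw [real_inner_comm]
    rw [e]
    have := intervalIntegral.norm_integral_le_of_norm_le_const (a := t) (b := t + k)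
      (C := ‖ξ‖ * (L * (M * k)))
      (f := fun r => innerSL ℝ ξ (P.f (y r) (α r) - P.f x (α r))) (fun r hr => by
        rw [uIoc_of_le hs.1] at hr
        have h1 := h.norm_traj_sub_le hα ht' ⟨hr.1.le, hr.2.trans hs.2⟩ x
        have h2 := h.f_lip (y r) x _ (hα.2 r (ht.1.trans hr.1.le))
        have h3 : r - t ≤ k := by linarith [hr.2]
        have h4 := norm_inner_le_norm (𝕜 := ℝ) ξ (P.f (y r) (α r) - P.f x (α r))
        refine h4.trans (mul_le_mul_of_nonneg_left (h2.trans ?_) (norm_nonneg _))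
        exact mul_le_mul_of_nonneg_left (h1.trans (mul_le_mul_of_nonneg_left h3 hM)) hL.le)
    rw [add_sub_cancel_left, abs_of_pos hk] at this
    refine this.trans (mul_le_mul_of_nonneg_right ?_ hk.le)
    linarith
  have hR : |P.runCost x t α (t + k) - ∫ r in t..t + k, P.ℓ x (α r) t| ≤ η / 2 * k := by
    rw [runCost, ← intervalIntegral.integral_sub hI4 hI3]
    have := intervalIntegral.norm_integral_le_of_norm_le_const (a := t) (b := t + k)
      (C := η / 2)
      (f := fun r => Real.exp (-P.lam * (r - t)) * P.ℓ (P.traj x t α r) (α r) r -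
        P.ℓ x (α r) t) (fun r hr => by
        rw [uIoc_of_le hs.1] at hr
        have hr' : r ∈ Icc t (t + k) := ⟨hr.1.le, hr.2⟩
        have hr0 : r ∈ Icc 0 P.T := ⟨ht.1.trans hr.1.le, hr.2.trans hs.2⟩
        have hαr := hα.2 r hr0.1
        have d1 := hk2.2 α hα r hr'
        have d2 := hk3.2 α hα r hr'
        rw [Prod.dist_eq, max_lt_iff, dist_eq_norm, Real.dist_eq] at d1 d2
        have h1 := hℓ (y r) x (by
          have := norm_le_norm_add_norm_sub x (y r)
          linarith [norm_sub_rev x (y r), d2.1]) (by linarith) d1.1 r hr0 t ht' d1.2 _ hαr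
        have h2 := h.ℓ_nonneg (y r) _ hαr r hr0
        have h3 := h.ℓ_le (y r) _ hαr r hr0
        have h4 := one_sub_le_exp P t r
        have h5 := h.exp_le_one hr.1.le
        have h6 : P.lam * (r - t) ≤ P.lam * k :=
          mul_le_mul_of_nonneg_left (by linarith [hr.2]) h.lam_nonneg
        have h7 : |(Real.exp (-P.lam * (r - t)) - 1) * P.ℓ (y r) (α r) r| ≤ η / 4 := by
          rw [abs_mul, abs_of_nonneg h2, abs_of_nonpos (by linarith)]
          have h8 : -(Real.exp (-P.lam * (r - t)) - 1) ≤ P.lam * k := by linarith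
          have h9 : 0 ≤ P.lam * k := mul_nonneg h.lam_nonneg hk.le
          have := mul_le_mul h8 h3 h2 h9
          linarith
        rw [Real.norm_eq_abs]
        have h10 := abs_add_le ((Real.exp (-P.lam * (r - t)) - 1) * P.ℓ (y r) (α r) r)
          (P.ℓ (y r) (α r) r - P.ℓ x (α r) t)
        have e : (Real.exp (-P.lam * (r - t)) - 1) * P.ℓ (y r) (α r) r +
          (P.ℓ (y r) (α r) r - P.ℓ x (α r) t) =
          Real.exp (-P.lam * (r - t)) * P.ℓ (y r) (α r) r - P.ℓ x (α r) t := by ring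
        rw [e] at h10
        linarith)
    rwa [add_sub_cancel_left, abs_of_pos hk] at this
  have hsplit : ∫ r in t..t + k, (q + inner ℝ (P.f x (α r)) ξ + P.ℓ x (α r) t) =
      k * q + (∫ r in t..t + k, inner ℝ (P.f x (α r)) ξ) + ∫ r in t..t + k, P.ℓ x (α r) t := by
    rw [intervalIntegral.integral_add (intervalIntegrable_const.add hI1') hI3,
      intervalIntegral.integral_add intervalIntegrable_const hI1']
    simp
  rw [hsplit]
  rw [hD] at hA
  rw [abs_le] at hA hB hR ⊢
  constructor <;> linarith [hA.1, hA.2, hB.1, hB.2, hR.1, hR.2]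

/-- First-order expansion of the discount of the value function along trajectories, uniformly in
the control. -/
theorem eventually_abs_discount_le (h : P.IsRegular M L C) (ht : t ∈ Ico 0 P.T) {η : ℝ}
    (hη : 0 < η) (x : EuclideanSpace ℝ (Fin d)) : ∀ᶠ k in 𝓝[>] (0 : ℝ), ∀ α ∈ P.controls,
      |(1 - Real.exp (-P.lam * (t + k - t))) * P.V (P.traj x t α (t + k)) (t + k) -
        P.lam * P.V x t * k| ≤ η * k := by
  have hl := h.lam_nonneg
  have hC := h.C_nonneg
  obtain ⟨δ, hδ, hV⟩ := Metric.uniformContinuousOn_iff.1 h.isBUC_V.2 (η / (2 * (P.lam + 1)))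
    (by positivity)
  filter_upwards [h.eventually_dist_traj_lt ht hδ x, eventually_mul_lt (P.lam ^ 2 * C)
    (show 0 < η / 2 by positivity), self_mem_nhdsWithin] with k hk1 hk2 hk0 α hα
  have hk : 0 < k := hk0
  have hs0 : t + k ∈ Icc 0 P.T := ⟨by linarith [ht.1], hk1.1.le⟩
  have h1 := hV (P.traj x t α (t + k), t + k) ⟨trivial, hs0⟩ (x, t)
    ⟨trivial, ht.1, ht.2.le⟩ (hk1.2 α hα _ ⟨by linarith, le_rfl⟩)
  rw [Real.dist_eq] at h1
  simp only at h1
  set v := P.V (P.traj x t α (t + k)) (t + k)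
  have hv0 : 0 ≤ v := h.V_nonneg hs0
  have hvC : v ≤ C := h.V_le hs0
  rw [add_sub_cancel_left]
  set u := P.lam * k with hu
  have hu0 : 0 ≤ u := mul_nonneg hl hk.le
  have e1 : 1 - u ≤ Real.exp (-P.lam * k) := by
    linarith [Real.add_one_le_exp (-P.lam * k)]
  -- `exp (-u) ≤ 1 / (1 + u) ≤ 1 - u + u ^ 2`
  have e2 : Real.exp (-P.lam * k) ≤ 1 - u + u ^ 2 := by
    have h2 : Real.exp (-P.lam * k) * Real.exp u = 1 := by
      rw [← Real.exp_add, hu]; simp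
    have h3 := Real.add_one_le_exp u
    have h4 := Real.exp_pos (-P.lam * k)
    have h5 : Real.exp (-P.lam * k) * (1 + u) ≤ 1 := by nlinarith
    have h6 : (1 : ℝ) ≤ (1 - u + u ^ 2) * (1 + u) := by nlinarith [pow_nonneg hu0 3]
    exact le_of_mul_le_mul_right (h5.trans h6) (by linarith)
  have hfirst : |(1 - Real.exp (-P.lam * k) - u) * v| ≤ η / 2 * k := by
    rw [abs_mul, abs_of_nonneg hv0, abs_of_nonpos (by linarith)]
    have h2 : -(1 - Real.exp (-P.lam * k) - u) ≤ u ^ 2 := by linarith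
    refine (mul_le_mul h2 hvC hv0 (sq_nonneg u)).trans ?_
    have : u ^ 2 * C = P.lam ^ 2 * C * k * k := by rw [hu]; ring
    rw [this]
    exact mul_le_mul_of_nonneg_right hk2.le hk.le
  have hsecond : |u * (v - P.V x t)| ≤ η / 2 * k := by
    rw [abs_mul, abs_of_nonneg hu0]
    refine (mul_le_mul_of_nonneg_left h1.le hu0).trans ?_
    rw [hu, mul_div_assoc', div_le_iff₀ (by positivity)]
    nlinarith [mul_nonneg hη.le hk.le, mul_nonneg hl (mul_nonneg hη.le hk.le)]
  have e : (1 - Real.exp (-P.lam * k)) * v - P.lam * P.V x t * k =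
      (1 - Real.exp (-P.lam * k) - u) * v + u * (v - P.V x t) := by rw [hu]; ring
  rw [e]
  exact (abs_add_le _ _).trans (by linarith)

/-- Constant controls suffice for the subsolution inequality. -/
theorem isViscositySubsolution_V (h : P.IsRegular M L C) : P.IsViscositySubsolution P.V := by
  intro φ hφ x t ht hmax
  have ht' : t ∈ Icc 0 P.T := ⟨ht.1, ht.2.le⟩
  have hd : DifferentiableAt ℝ φ (x, t) := (hφ.differentiable one_ne_zero) _
  set q := deriv (fun s => φ (x, s)) t
  set ξ := gradient (fun z => φ (z, t)) x
  refine max_le (sub_nonpos.2 (h.V_le_ψ ht')) ?_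
  suffices P.H x t ξ ≤ q - P.lam * P.V x t by linarith
  refine h.H_le fun a ha => le_of_forall_pos_le_add fun η hη => ?_
  have hα : (fun _ => a) ∈ P.controls := const_mem_controls ha
  obtain ⟨δ, hδ, hloc⟩ := Metric.mem_nhdsWithin_iff.1 hmax
  obtain ⟨k, hexp, hdis, hk1, hk0⟩ := ((h.eventually_abs_expansion_le ht hd.hasFDerivAt
    (fderiv_prod_apply_eq_inner_gradient_add hd) (show 0 < η / 2 by positivity)).and
    ((h.eventually_abs_discount_le ht (show 0 < η / 2 by positivity) x).and
    ((h.eventually_dist_traj_lt ht hδ x).and self_mem_nhdsWithin))).exists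
  have hk : 0 < k := hk0
  have hs : t + k ∈ Icc t P.T := ⟨by linarith, hk1.1.le⟩
  have h1 := hexp _ hα
  have h2 := hdis _ hα
  have h3 := h.V_le_cost_V (x := x) hα ht' hs
  have h4 : P.V (P.traj x t (fun _ => a) (t + k)) (t + k) -
      φ (P.traj x t (fun _ => a) (t + k), t + k) ≤ P.V x t - φ (x, t) :=
    hloc (a := (P.traj x t (fun _ => a) (t + k), t + k))
      ⟨hk1.2 _ hα _ ⟨by linarith, le_rfl⟩, trivial, by linarith [ht.1], hk1.1⟩
  rw [cost] at h3
  simp only [intervalIntegral.integral_const, add_sub_cancel_left, smul_eq_mul] at h1 h2 h3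
  have h5 := (abs_le.1 h1).2
  have h6 := (abs_le.1 h2).1
  have h7 : (-inner ℝ (P.f x a) ξ - P.ℓ x a t) * k ≤ (q - P.lam * P.V x t + η) * k := by
    linarith
  exact le_of_mul_le_mul_right h7 hk

theorem isViscositySupersolution_V (h : P.IsRegular M L C) : P.IsViscositySupersolution P.V := by
  intro φ hφ x t ht hmin
  have ht' : t ∈ Icc 0 P.T := ⟨ht.1, ht.2.le⟩
  have hd : DifferentiableAt ℝ φ (x, t) := (hφ.differentiable one_ne_zero) _
  set q := deriv (fun s => φ (x, s)) t
  set ξ := gradient (fun z => φ (z, t)) x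
  rcases le_or_gt (P.ψ x t) (P.V x t) with hcon | hcon
  · exact le_max_of_le_left (sub_nonneg.2 hcon)
  refine le_max_of_le_right ?_
  suffices q - P.lam * P.V x t ≤ P.H x t ξ by linarith
  refine le_of_forall_pos_le_add fun η hη => ?_
  have hl := h.lam_nonneg
  set γ := P.ψ x t - P.V x t
  have hγ : 0 < γ := sub_pos.2 hcon
  obtain ⟨δ, hδ, hloc⟩ := Metric.mem_nhdsWithin_iff.1 hmin
  obtain ⟨δ', hδ', hψ⟩ := Metric.uniformContinuousOn_iff.1 h.ψ_cont (γ / 3) (by positivity)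
  obtain ⟨k, hexp, hdis, hk1, hk2, hk3, hk4, hk0⟩ :=
    ((h.eventually_abs_expansion_le ht hd.hasFDerivAt
    (fderiv_prod_apply_eq_inner_gradient_add hd) (show 0 < η / 3 by positivity)).and
    ((h.eventually_abs_discount_le ht (show 0 < η / 3 by positivity) x).and
    ((h.eventually_dist_traj_lt ht hδ x).and ((h.eventually_dist_traj_lt ht hδ' x).and
    ((eventually_mul_lt (η / 3) (show 0 < γ / 3 by positivity)).and
    ((eventually_mul_lt (P.lam * C) (show 0 < γ / 3 by positivity)).and
    self_mem_nhdsWithin)))))).exists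
  have hk : 0 < k := hk0
  have hs : t + k ∈ Icc t P.T := ⟨by linarith, hk1.1.le⟩
  obtain ⟨α, hα, τ, hτ, hJ⟩ := h.exists_J_lt ht' (show 0 < η / 3 * k by positivity) x
  rcases lt_or_ge τ (t + k) with hlt | hle
  · -- stopping before time `t + k` costs about `ψ x t`, more than `V x t + η / 3 * k`
    exfalso
    have hτ0 : τ ∈ Icc 0 P.T := ⟨ht.1.trans hτ.1, hτ.2⟩
    have h1 := h.runCost_nonneg (x := x) hα ht' hτ
    have h2 := one_sub_le_exp P t τ
    have h3 := h.ψ_nonneg (P.traj x t α τ) τ hτ0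
    have h4 := h.ψ_le (P.traj x t α τ) τ hτ0
    have h5 := hψ (P.traj x t α τ, τ) ⟨trivial, hτ0⟩ (x, t) ⟨trivial, ht'⟩
      (hk2.2 α hα τ ⟨hτ.1, hlt.le⟩)
    rw [Real.dist_eq] at h5
    have h6 := (abs_lt.1 h5).1
    have h7 := mul_le_mul_of_nonneg_right h2 h3
    have h8 : P.lam * (τ - t) * P.ψ (P.traj x t α τ) τ ≤ P.lam * k * C :=
      mul_le_mul (mul_le_mul_of_nonneg_left (by linarith) hl) h4 h3 (mul_nonneg hl hk.le)
    have h9 : P.ψ x t - P.V x t = γ := rfl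
    rw [J_eq_cost, cost] at hJ
    simp only at h6
    linarith
  have h1 := hexp _ hα
  have h2 := hdis _ hα
  have h3 := h.cost_V_le_J (x := x) hα ht' hs ⟨hle, hτ.2⟩
  have h4 : P.V x t - φ (x, t) ≤ P.V (P.traj x t α (t + k)) (t + k) -
      φ (P.traj x t α (t + k), t + k) :=
    hloc (a := (P.traj x t α (t + k), t + k))
      ⟨hk1.2 _ hα _ ⟨by linarith, le_rfl⟩, trivial, by linarith [ht.1], hk1.1⟩
  have hI : (q - P.H x t ξ) * k ≤
      ∫ r in t..t + k, (q + inner ℝ (P.f x (α r)) ξ + P.ℓ x (α r) t) := by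
    have hI3 : IntervalIntegrable (fun r => P.ℓ x (α r) t) volume t (t + k) :=
      h.intervalIntegrable_ℓ hα ht.1 hs.1 continuousOn_const continuousOn_const fun _ _ => ht'
    have e : (q - P.H x t ξ) * k = ∫ _ in t..t + k, (q - P.H x t ξ) := by
      rw [intervalIntegral.integral_const, add_sub_cancel_left, smul_eq_mul, mul_comm]
    rw [e]
    refine intervalIntegral.integral_mono_on hs.1 intervalIntegrable_const
      ((intervalIntegrable_const.add (h.intervalIntegrable_inner_f hα ht.1 hs.1 x ξ)).add hI3)
      fun r hr => ?_
    linarith [h.le_H ht' (hα.2 r (ht.1.trans hr.1)) x ξ]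
  rw [cost] at h3
  rw [add_sub_cancel_left] at h2 h3
  have h5 := (abs_le.1 h1).1
  have h6 := (abs_le.1 h2).2
  have h7 : (q - P.lam * P.V x t) * k ≤ (P.H x t ξ + η) * k := by
    linarith
  exact le_of_mul_le_mul_right h7 hk

theorem isBUCViscositySolution_V (h : P.IsRegular M L C) : P.IsBUCViscositySolution P.V :=
  ⟨h.isBUC_V, h.isViscositySubsolution_V, h.isViscositySupersolution_V, h.V_terminal⟩

end IsRegular
end StoppingProblem

/-! ### Comparison of viscosity sub- and supersolutions -/

/-- The quadratic test functions of the doubling of variables: `c` is the strength of the coupling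
to the point `(y, s)`, `b` that of the penalization at infinity, and `κ` is a slope in time. -/
def quadraticTest {E : Type*} [NormedAddCommGroup E] (c b κ : ℝ) (y : E) (s : ℝ)
    (z : E × ℝ) : ℝ :=
  c / 2 * ‖z.1 - y‖ ^ 2 + c / 2 * (z.2 - s) ^ 2 + b * ‖z.1‖ ^ 2 - κ * z.2

section QuadraticTest

variable {E : Type*} [NormedAddCommGroup E]

theorem deriv_quadraticTest (c b κ : ℝ) (y : E) (s : ℝ) (x : E) (t : ℝ) :
    deriv (fun r => quadraticTest c b κ y s (x, r)) t = c * (t - s) - κ := by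
  have h1 : HasDerivAt (fun r : ℝ => (r - s) ^ 2) _ t := ((hasDerivAt_id t).sub_const s).pow 2
  have h2 := (((h1.const_mul (c / 2)).const_add (c / 2 * ‖x - y‖ ^ 2)).add_const
    (b * ‖x‖ ^ 2)).sub ((hasDerivAt_id t).const_mul κ)
  refine (h2.congr_deriv (f' := _) ?_).deriv
  simp
  ring

variable [InnerProductSpace ℝ E]

theorem contDiff_quadraticTest (c b κ : ℝ) (y : E) (s : ℝ) :
    ContDiff ℝ 1 (quadraticTest c b κ y s) := by
  have h1 : ContDiff ℝ 1 fun z : E × ℝ => ‖z.1 - y‖ ^ 2 :=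
    (contDiff_fst.sub contDiff_const).norm_sq ℝ
  have h2 : ContDiff ℝ 1 fun z : E × ℝ => ‖z.1‖ ^ 2 := contDiff_fst.norm_sq ℝ
  unfold quadraticTest
  fun_prop

theorem gradient_quadraticTest [CompleteSpace E] (c b κ : ℝ) (y : E) (s : ℝ) (x : E) (t : ℝ) :
    gradient (fun z => quadraticTest c b κ y s (z, t)) x = c • (x - y) + (2 * b) • x := by
  apply HasGradientAt.gradient
  rw [hasGradientAt_iff_hasFDerivAt]
  have h1 := (((hasFDerivAt_id (𝕜 := ℝ) x).sub_const y).norm_sq).const_mul (c / 2)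
  have h2 := ((hasFDerivAt_id (𝕜 := ℝ) x).norm_sq).const_mul b
  refine (((h1.add_const (c / 2 * (t - s) ^ 2)).add h2).sub_const (κ * t)).congr_fderiv ?_
  ext v
  simp
  ring

end QuadraticTest

namespace StoppingProblem
variable {d m : ℕ} {P : StoppingProblem d m} {M L C : ℝ}
  {x x' : EuclideanSpace ℝ (Fin d)} {t s τ σ : ℝ} {α β : ℝ → EuclideanSpace ℝ (Fin m)}

namespace IsRegular

theorem H_le_H_add (h : P.IsRegular M L C) {ρ : ℝ} (ht : t ∈ Icc 0 P.T)
    (hℓ : ∀ a ∈ P.A, |P.ℓ x a t - P.ℓ x' a s| ≤ ρ) (ξ ζ : EuclideanSpace ℝ (Fin d)) :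
    P.H x' s ξ ≤ P.H x t (ξ + ζ) + L * ‖x - x'‖ * ‖ξ‖ + M * ‖ζ‖ + ρ := by
  refine h.H_le fun a ha => ?_
  have h1 := h.le_H ht ha x (ξ + ζ)
  have h2 := (abs_le.1 (hℓ a ha)).2
  have h3 := real_inner_le_norm (P.f x a - P.f x' a) ξ
  have h4 := mul_le_mul_of_nonneg_right (h.f_lip x x' a ha) (norm_nonneg ξ)
  have h5 := real_inner_le_norm (P.f x a) ζ
  have h6 := mul_le_mul_of_nonneg_right (h.f_le x a ha) (norm_nonneg ζ)
  rw [inner_sub_left] at h3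
  rw [inner_add_right] at h1
  linarith

/-- A maximum point of the doubled and penalized difference of `u` and `v`. The penalization
`b * ‖x‖ ^ 2` confines the maximum point to a ball whose radius does not depend on `n`. -/
theorem exists_max_doubling {u v : EuclideanSpace ℝ (Fin d) → ℝ → ℝ} {T K b κ n : ℝ}
    (hb : 0 < b) (hκ : 0 ≤ κ) (hn : 1 ≤ n)
    (hu : ContinuousOn (fun z : EuclideanSpace ℝ (Fin d) × ℝ => u z.1 z.2) (univ ×ˢ Icc 0 T))
    (hv : ContinuousOn (fun z : EuclideanSpace ℝ (Fin d) × ℝ => v z.1 z.2) (univ ×ˢ Icc 0 T))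
    (hK : ∀ x, ∀ t ∈ Icc 0 T, ∀ y, ∀ s ∈ Icc 0 T, u x t - v y s + κ * T ≤ K)
    {x₀ : EuclideanSpace ℝ (Fin d)} {t₀ : ℝ} (ht₀ : t₀ ∈ Icc 0 T)
    (h₀ : b * ‖x₀‖ ^ 2 ≤ u x₀ t₀ - v x₀ t₀) :
    ∃ x, ∃ t ∈ Icc 0 T, ∃ y, ∃ s ∈ Icc 0 T,
      (∀ x', ∀ t' ∈ Icc 0 T, ∀ y', ∀ s' ∈ Icc 0 T,
        u x' t' - v y' s' - quadraticTest n b κ y' s' (x', t') ≤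
          u x t - v y s - quadraticTest n b κ y s (x, t)) ∧
      b * ‖x‖ ^ 2 ≤ K ∧ n / 2 * ‖x - y‖ ^ 2 ≤ K ∧ n / 2 * (t - s) ^ 2 ≤ K ∧
      ‖x‖ ≤ √(K / b) + √(2 * K) ∧ ‖y‖ ≤ √(K / b) + √(2 * K) := by
  have hn0 : 0 < n := by linarith
  let Φ : (EuclideanSpace ℝ (Fin d) × ℝ) × (EuclideanSpace ℝ (Fin d) × ℝ) → ℝ := fun w =>
    u w.1.1 w.1.2 - v w.2.1 w.2.2 - quadraticTest n b κ w.2.1 w.2.2 w.1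
  set R := √(K / b) + √(2 * K)
  have hest : ∀ x, ∀ t ∈ Icc 0 T, ∀ y, ∀ s ∈ Icc 0 T,
      Φ ((x₀, t₀), (x₀, t₀)) ≤ Φ ((x, t), (y, s)) →
      b * ‖x‖ ^ 2 ≤ K ∧ n / 2 * ‖x - y‖ ^ 2 ≤ K ∧ n / 2 * (t - s) ^ 2 ≤ K ∧
        ‖x‖ ≤ R ∧ ‖y‖ ≤ R := by
    intro x t ht y s hs hle
    have h1 := hK x t ht y s hs
    have h2 : κ * t ≤ κ * T := mul_le_mul_of_nonneg_left ht.2 hκ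
    have h3 : 0 ≤ κ * t₀ := mul_nonneg hκ ht₀.1
    have h4 : 0 ≤ n / 2 * ‖x - y‖ ^ 2 := by positivity
    have h5 : 0 ≤ n / 2 * (t - s) ^ 2 := by positivity
    have h6 : 0 ≤ b * ‖x‖ ^ 2 := by positivity
    simp only [Φ, quadraticTest, sub_self, norm_zero] at hle
    have h7 : b * ‖x‖ ^ 2 ≤ K := by linarith
    have h8 : n / 2 * ‖x - y‖ ^ 2 ≤ K := by linarith
    have h9 : ‖x‖ ≤ √(K / b) := Real.le_sqrt_of_sq_le (by
      rw [le_div_iff₀ hb]; linarith)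
    have h10 : ‖x - y‖ ≤ √(2 * K) := Real.le_sqrt_of_sq_le (by nlinarith [sq_nonneg ‖x - y‖])
    refine ⟨h7, h8, by linarith, ?_, ?_⟩
    · linarith [Real.sqrt_nonneg (2 * K)]
    · linarith [norm_le_norm_add_norm_sub x y, norm_sub_rev x y]
  let S : Set ((EuclideanSpace ℝ (Fin d) × ℝ) × (EuclideanSpace ℝ (Fin d) × ℝ)) :=
    (Metric.closedBall 0 R ×ˢ Icc 0 T) ×ˢ (Metric.closedBall 0 R ×ˢ Icc 0 T)
  have hS : IsCompact S := ((isCompact_closedBall _ _).prod isCompact_Icc).prod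
    ((isCompact_closedBall _ _).prod isCompact_Icc)
  have h0S : ((x₀, t₀), (x₀, t₀)) ∈ S := by
    have := hest x₀ t₀ ht₀ x₀ t₀ ht₀ le_rfl
    exact ⟨⟨by simpa using this.2.2.2.1, ht₀⟩, ⟨by simpa using this.2.2.2.1, ht₀⟩⟩
  have hΦ : ContinuousOn Φ S := by
    have h1 : ContinuousOn (fun w : (EuclideanSpace ℝ (Fin d) × ℝ) ×
        (EuclideanSpace ℝ (Fin d) × ℝ) => u w.1.1 w.1.2) S :=
      hu.comp continuousOn_fst fun w hw => ⟨trivial, hw.1.2⟩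
    have h2 : ContinuousOn (fun w : (EuclideanSpace ℝ (Fin d) × ℝ) ×
        (EuclideanSpace ℝ (Fin d) × ℝ) => v w.2.1 w.2.2) S :=
      hv.comp continuousOn_snd fun w hw => ⟨trivial, hw.2.2⟩
    refine (h1.sub h2).sub (Continuous.continuousOn ?_)
    unfold quadraticTest
    fun_prop
  obtain ⟨⟨⟨x, t⟩, ⟨y, s⟩⟩, hmem, hmax⟩ := hS.exists_isMaxOn ⟨_, h0S⟩ hΦ
  have hbase : Φ ((x₀, t₀), (x₀, t₀)) ≤ Φ ((x, t), (y, s)) := hmax h0S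
  refine ⟨x, t, hmem.1.2, y, s, hmem.2.2, fun x' t' ht' y' s' hs' => ?_,
    hest x t hmem.1.2 y s hmem.2.2 hbase⟩
  change Φ ((x', t'), (y', s')) ≤ Φ ((x, t), (y, s))
  rcases le_total (Φ ((x₀, t₀), (x₀, t₀))) (Φ ((x', t'), (y', s'))) with hle | hle
  · have := hest x' t' ht' y' s' hs' hle
    exact hmax (a := ((x', t'), (y', s')))
      ⟨⟨by simpa using this.2.2.2.1, ht'⟩, ⟨by simpa using this.2.2.2.2, hs'⟩⟩
  · exact hle.trans hbase

/-- The comparison principle. The variables are doubled; the term `-κ * t` in the test function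
makes the subsolution strict, which replaces a positive discount factor. -/
theorem le_of_sub_super (h : P.IsRegular M L C) {u v : EuclideanSpace ℝ (Fin d) → ℝ → ℝ}
    (hu : P.IsBUC u) (hv : P.IsBUC v) (hsub : P.IsViscositySubsolution u)
    (hsup : P.IsViscositySupersolution v) (hterm : ∀ x, u x P.T ≤ v x P.T) :
    ∀ x, ∀ t ∈ Icc 0 P.T, u x t ≤ v x t := by
  by_contra! hcon
  obtain ⟨x₀, t₀, ht₀, hlt⟩ := hcon
  have hT := h.T_pos
  have hL := h.L_pos
  have hM := h.M_nonneg
  obtain ⟨⟨B₁, hB₁⟩, hu⟩ := hu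
  obtain ⟨⟨B₂, hB₂⟩, hv⟩ := hv
  set θ := u x₀ t₀ - v x₀ t₀ with hθ
  have hθ0 : 0 < θ := sub_pos.2 hlt
  set κ := θ / (4 * P.T) with hκ
  have hκ0 : 0 < κ := by positivity
  have hκT : κ * P.T = θ / 4 := by rw [hκ]; field_simp
  set K := B₁ + B₂ + κ * P.T + 1 with hKdef
  have hK : ∀ x, ∀ t ∈ Icc 0 P.T, ∀ y, ∀ s ∈ Icc 0 P.T, u x t - v y s + κ * P.T ≤ K :=
    fun x t ht y s hs => by
      have h1 := (abs_le.1 (hB₁ x t ht)).2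
      have h2 := (abs_le.1 (hB₂ y s hs)).1
      linarith
  have hK0 : 0 < K := by
    have h1 := (abs_nonneg _).trans (hB₁ x₀ t₀ ht₀)
    have h2 := (abs_nonneg _).trans (hB₂ x₀ t₀ ht₀)
    have : 0 ≤ κ * P.T := by positivity
    linarith
  -- `b` is small enough for the penalization to be harmless at `x₀` and in the Hamiltonian
  obtain ⟨b, hb0, hb1, hb2⟩ : ∃ b > 0, b * ‖x₀‖ ^ 2 ≤ θ / 4 ∧ b * (K * (4 * M) ^ 2) ≤ κ ^ 2 := by
    have := (((eventually_mul_lt (‖x₀‖ ^ 2) (show 0 < θ / 4 by positivity)).and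
      (eventually_mul_lt (K * (4 * M) ^ 2) (show 0 < κ ^ 2 by positivity))).and
      self_mem_nhdsWithin).exists
    obtain ⟨b, ⟨h1, h2⟩, h3⟩ := this
    exact ⟨b, h3, by linarith, by linarith⟩
  set R := √(K / b) + √(2 * K)
  set ρ := min (θ / 4) (κ / (16 * L)) with hρ
  have hρ0 : 0 < ρ := by positivity
  have hρ1 : ρ ≤ θ / 4 := min_le_left _ _
  have hρ2 : L * (2 * ρ) ≤ κ / 8 := by
    have : ρ ≤ κ / (16 * L) := min_le_right _ _
    rw [le_div_iff₀ (by positivity)] at this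
    linarith
  obtain ⟨r₁, hr₁, hu1⟩ := Metric.uniformContinuousOn_iff.1 hu ρ hρ0
  obtain ⟨r₂, hr₂, hv1⟩ := Metric.uniformContinuousOn_iff.1 hv ρ hρ0
  obtain ⟨r₃, hr₃, hψ1⟩ := Metric.uniformContinuousOn_iff.1 h.ψ_cont ρ hρ0
  obtain ⟨r₄, hr₄, hℓ1⟩ := h.ℓ_uniform_on_ball R (show 0 < κ / 8 by positivity)
  obtain ⟨r, hr, hr1, hr2, hr3, hr4⟩ : ∃ r > 0, r ≤ r₁ ∧ r ≤ r₂ ∧ r ≤ r₃ ∧ r ≤ r₄ :=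
    ⟨min (min r₁ r₂) (min r₃ r₄), by positivity, by simp, by simp, by simp, by simp⟩
  set n := 2 * K / r ^ 2 + 1 with hn
  have hn1 : 1 ≤ n := by
    have : 0 ≤ 2 * K / r ^ 2 := by positivity
    linarith
  have hnr : 2 * K < n * r ^ 2 := by
    rw [hn, add_mul, div_mul_cancel₀ _ (by positivity)]
    have := pow_pos hr 2
    linarith
  have hn0 : 0 < n := by linarith
  obtain ⟨x, t, ht, y, s, hs, hmax, hx1, hx2, hx3, hxR, hyR⟩ :=
    exists_max_doubling hb0 hκ0.le hn1 hu.continuousOn hv.continuousOn hK ht₀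
      (by linarith)
  have hxy : ‖x - y‖ < r := by
    refine lt_of_pow_lt_pow_left₀ 2 hr.le ?_
    exact lt_of_mul_lt_mul_left (by linarith : n * ‖x - y‖ ^ 2 < n * r ^ 2) hn0.le
  have hts : |t - s| < r := by
    refine lt_of_pow_lt_pow_left₀ 2 hr.le ?_
    rw [sq_abs]
    exact lt_of_mul_lt_mul_left (by linarith : n * (t - s) ^ 2 < n * r ^ 2) hn0.le
  have hdist : dist (x, t) (y, s) < r := by
    rw [Prod.dist_eq, max_lt_iff, dist_eq_norm, Real.dist_eq]
    exact ⟨hxy, hts⟩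
  have hux := hu1 (x, t) ⟨trivial, ht⟩ (y, s) ⟨trivial, hs⟩ (hdist.trans_le hr1)
  have hvx := hv1 (x, t) ⟨trivial, ht⟩ (y, s) ⟨trivial, hs⟩ (hdist.trans_le hr2)
  have hψx := hψ1 (x, t) ⟨trivial, ht⟩ (y, s) ⟨trivial, hs⟩ (hdist.trans_le hr3)
  rw [Real.dist_eq] at hux hvx hψx
  simp only at hux hvx hψx
  have hquad : 0 ≤ n / 2 * (t - s) ^ 2 := by positivity
  have hquad' : 0 ≤ n / 2 * ‖x - y‖ ^ 2 := by positivity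
  have hquad'' : 0 ≤ b * ‖x‖ ^ 2 := by positivity
  have huv : θ / 2 ≤ u x t - v y s := by
    have h1 := hmax x₀ t₀ ht₀ x₀ t₀ ht₀
    have h2 : κ * t ≤ κ * P.T := mul_le_mul_of_nonneg_left ht.2 hκ0.le
    have h3 : 0 ≤ κ * t₀ := mul_nonneg hκ0.le ht₀.1
    simp only [quadraticTest, sub_self, norm_zero] at h1
    linarith
  -- comparing with the diagonal point `(x, t)` bounds the penalization by the modulus of `v`
  have hpen : n * ‖x - y‖ ^ 2 ≤ 2 * ρ := by
    have h1 := hmax x t ht x t ht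
    simp only [quadraticTest, sub_self, norm_zero] at h1
    linarith [(abs_lt.1 hvx).2]
  -- at the horizon, the terminal inequality contradicts `huv`
  have htT : t < P.T := by
    refine lt_of_le_of_ne ht.2 fun e => ?_
    have := hterm x
    rw [e] at huv hvx
    linarith [(abs_lt.1 hvx).2]
  have hsT : s < P.T := by
    refine lt_of_le_of_ne hs.2 fun e => ?_
    have := hterm y
    rw [e] at huv hux
    linarith [(abs_lt.1 hux).2]
  have hS := hsub (quadraticTest n b κ y s) (contDiff_quadraticTest _ _ _ _ _) x t ⟨ht.1, htT⟩
    (eventually_nhdsWithin_of_forall fun z hz => by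
      have := hmax z.1 z.2 ⟨hz.2.1, hz.2.2.le⟩ y s hs
      simp only
      linarith)
  have hP := hsup (quadraticTest (-n) 0 0 x t) (contDiff_quadraticTest _ _ _ _ _) y s ⟨hs.1, hsT⟩
    (eventually_nhdsWithin_of_forall fun z hz => by
      have := hmax x t ht z.1 z.2 ⟨hz.2.1, hz.2.2.le⟩
      simp only [quadraticTest] at this ⊢
      rw [norm_sub_rev z.1, norm_sub_rev y]
      linarith)
  rw [deriv_quadraticTest, gradient_quadraticTest] at hS hP
  rw [obstacleOp, max_le_iff] at hS
  rw [obstacleOp, le_max_iff] at hP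
  have hgrad : -n • (y - x) + (2 * (0 : ℝ)) • y = n • (x - y) := by
    rw [mul_zero, zero_smul, add_zero, neg_smul, ← smul_neg, neg_sub]
  rw [hgrad] at hP
  have hP' : 0 ≤ -(-n * (s - t) - 0) + P.lam * v y s + P.H y s (n • (x - y)) := by
    -- `v ≥ ψ` at `(y, s)` and `u ≤ ψ` at the nearby point `(x, t)` contradict `huv`
    refine hP.resolve_left fun hv' => ?_
    linarith [hS.1, (abs_lt.1 hψx).2]
  have hH := h.H_le_H_add (x := x) (x' := y) (t := t) (s := s) (ρ := κ / 8) ht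
    (fun a ha => (hℓ1 x y hxR hyR (hxy.trans_le hr4) t ht s hs (hts.trans_le hr4) a ha).le)
    (n • (x - y)) ((2 * b) • x)
  rw [norm_smul, norm_smul, Real.norm_of_nonneg hn0.le,
    Real.norm_of_nonneg (by positivity : 0 ≤ 2 * b)] at hH
  have h1 : L * ‖x - y‖ * (n * ‖x - y‖) ≤ κ / 8 := by
    have : L * ‖x - y‖ * (n * ‖x - y‖) = L * (n * ‖x - y‖ ^ 2) := by ring
    rw [this]
    exact (mul_le_mul_of_nonneg_left hpen hL.le).trans hρ2
  have h2 : 4 * M * (b * ‖x‖) ≤ κ := by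
    refine le_of_sq_le_sq ?_ hκ0.le
    calc (4 * M * (b * ‖x‖)) ^ 2 = b * (4 * M) ^ 2 * (b * ‖x‖ ^ 2) := by ring
      _ ≤ b * (4 * M) ^ 2 * K := mul_le_mul_of_nonneg_left hx1 (by positivity)
      _ ≤ κ ^ 2 := by linarith
  have h3 : 0 ≤ P.lam * (u x t - v y s) := mul_nonneg h.lam_nonneg (by linarith)
  linarith [hS.2]

/-- Two solutions coincide by comparison in both directions. -/
theorem eq_V_of_isBUCViscositySolution (h : P.IsRegular M L C)
    {u : EuclideanSpace ℝ (Fin d) → ℝ → ℝ} (hu : P.IsBUCViscositySolution u)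
    (x : EuclideanSpace ℝ (Fin d)) (ht : t ∈ Icc 0 P.T) : u x t = P.V x t := by
  have hV := h.isBUCViscositySolution_V
  refine le_antisymm ?_ ?_
  · exact h.le_of_sub_super hu.buc hV.buc hu.sub hV.super
      (fun z => (hu.terminal z).trans (hV.terminal z).symm |>.le) x t ht
  · exact h.le_of_sub_super hV.buc hu.buc hV.sub hu.super
      (fun z => (hV.terminal z).trans (hu.terminal z).symm |>.le) x t ht

end IsRegular

/-! ### Stopping at the first contact with the obstacle -/

/-- Controls that agree on longer and longer time intervals can be glued to one control. -/
theorem exists_control_eqOn {β : ℕ → ℝ → EuclideanSpace ℝ (Fin m)} {σ : ℕ → ℝ}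
    (hβ : ∀ n, β n ∈ P.controls) (hσ : Monotone σ)
    (hβσ : ∀ n, EqOn (β n) (β (n + 1)) (Iio (σ n))) :
    ∃ α ∈ P.controls, ∀ n, EqOn α (β n) (Iio (σ n)) := by
  have hle : ∀ n k, n ≤ k → EqOn (β k) (β n) (Iio (σ n)) := by
    intro n k hnk
    induction k, hnk using Nat.le_induction with
    | base => exact fun _ _ => rfl
    | succ k hk ih =>
      exact fun s hs => ((hβσ k (lt_of_lt_of_le hs (hσ hk))).symm).trans (ih hs)
  have hev : ∀ n, ∀ s < σ n, ∀ᶠ k in atTop, concat (σ k) (β k) (β 0) s = β n s := by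
    intro n s hs
    filter_upwards [eventually_ge_atTop n] with k hk
    rw [concat_eqOn_left (hs.trans_le (hσ hk) : s ∈ Iio (σ k)), hle n k hk hs]
  have hlim : ∀ s, ∃ a, ∀ᶠ k in atTop, concat (σ k) (β k) (β 0) s = a := by
    intro s
    by_cases hs : ∃ n, s < σ n
    · obtain ⟨n, hn⟩ := hs
      exact ⟨_, hev n s hn⟩
    · push Not at hs
      exact ⟨β 0 s, Eventually.of_forall fun k => concat_eqOn_right (hs k : s ∈ Ici (σ k))⟩
  choose α hα using hlim
  refine ⟨α, ⟨?_, fun s hs => ?_⟩, fun n s hs => ?_⟩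
  · refine measurable_of_tendsto_metrizable (f := fun k => (Ici (0 : ℝ)).domRestrict
      (concat (σ k) (β k) (β 0))) (fun k => (concat_mem_controls (hβ k) (hβ 0)).1) ?_
    rw [tendsto_pi_nhds]
    exact fun s => tendsto_const_nhds.congr' ((hα s).mono fun k hk => hk.symm)
  · obtain ⟨k, hk⟩ := (hα s).exists
    rw [← hk]
    exact (concat_mem_controls (hβ k) (hβ 0)).2 s hs
  · obtain ⟨k, hk1, hk2⟩ := ((hα s).and (hev n s hs)).exists
    rw [← hk1, hk2]

namespace IsRegular

theorem continuousOn_along_traj (h : P.IsRegular M L C) (hα : α ∈ P.controls)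
    (ht : t ∈ Icc 0 P.T) {W : EuclideanSpace ℝ (Fin d) → ℝ → ℝ}
    (hW : ContinuousOn (fun z : EuclideanSpace ℝ (Fin d) × ℝ => W z.1 z.2) (univ ×ˢ Icc 0 P.T))
    (x : EuclideanSpace ℝ (Fin d)) :
    ContinuousOn (fun s => W (P.traj x t α s) s) (Icc t P.T) :=
  hW.comp ((h.continuousOn_traj hα ht x).prodMk continuousOn_id)
    fun _ hs => ⟨trivial, ht.1.trans hs.1, hs.2⟩

theorem continuousOn_cost (h : P.IsRegular M L C) (hα : α ∈ P.controls)
    (ht : t ∈ Icc 0 P.T) {W : EuclideanSpace ℝ (Fin d) → ℝ → ℝ}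
    (hW : ContinuousOn (fun z : EuclideanSpace ℝ (Fin d) × ℝ => W z.1 z.2) (univ ×ˢ Icc 0 P.T))
    (x : EuclideanSpace ℝ (Fin d)) : ContinuousOn (P.cost W x t α) (Icc t P.T) := by
  have h1 := intervalIntegral.continuousOn_primitive_interval'
    (h.intervalIntegrable_runCost hα ht ⟨ht.2, le_rfl⟩ x) left_mem_uIcc
  rw [uIcc_of_le ht.2] at h1
  exact h1.add (ContinuousOn.mul (by fun_prop) (h.continuousOn_along_traj hα ht hW x))

/-- The set of contact times is closed and contains the horizon, so the first contact time is
attained. -/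
theorem hitTime_mem (h : P.IsRegular M L C) (hα : α ∈ P.controls) (ht : t ∈ Icc 0 P.T)
    (x : EuclideanSpace ℝ (Fin d)) : P.hitTime P.V x t α ∈ Icc t P.T ∧
      P.V (P.traj x t α (P.hitTime P.V x t α)) (P.hitTime P.V x t α) =
        P.ψ (P.traj x t α (P.hitTime P.V x t α)) (P.hitTime P.V x t α) := by
  have hc := (h.continuousOn_along_traj hα ht h.isBUC_V.2.continuousOn x).sub
    (h.continuousOn_along_traj hα ht h.ψ_cont.continuousOn x)
  have hclosed : IsClosed {τ | τ ∈ Icc t P.T ∧ P.V (P.traj x t α τ) τ =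
      P.ψ (P.traj x t α τ) τ} := by
    convert hc.preimage_isClosed_of_isClosed isClosed_Icc (isClosed_singleton (x := (0 : ℝ)))
      using 1
    ext τ
    simp [sub_eq_zero]
  exact hclosed.csInf_mem ⟨P.T, ⟨ht.2, le_rfl⟩, h.V_terminal _⟩ ⟨t, fun _ hτ => hτ.1.1⟩

/-- One step of the construction of an almost optimal control that is stopped at the first
contact: continue with an `ε`-optimal pair from the current position. Stopping there is almost
optimal, so there the obstacle exceeds the value function only slightly. -/
theorem exists_continuation (h : P.IsRegular M L C) (ht : t ∈ Icc 0 P.T)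
    (x : EuclideanSpace ℝ (Fin d)) (q : P.controls × Icc t P.T) {ε : ℝ} (hε : 0 < ε) :
    ∃ q' : P.controls × Icc t P.T, (q.2 : ℝ) ≤ q'.2 ∧
      EqOn (q.1 : ℝ → EuclideanSpace ℝ (Fin m)) q'.1 (Iio (q.2 : ℝ)) ∧
      P.cost P.V x t q'.1 q'.2 ≤ P.cost P.V x t q.1 q.2 + ε ∧
      P.ψ (P.traj x t q'.1 q'.2) q'.2 - P.V (P.traj x t q'.1 q'.2) q'.2 ≤
        ε * Real.exp (P.lam * P.T) := by
  obtain ⟨⟨β, hβ⟩, ⟨σ, hσ⟩⟩ := q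
  have hσ0 : σ ∈ Icc 0 P.T := ⟨ht.1.trans hσ.1, hσ.2⟩
  obtain ⟨γ, hγ, τ, hτ, hJ⟩ := h.exists_J_lt hσ0 hε (P.traj x t β σ)
  have hc : concat σ β γ ∈ P.controls := concat_mem_controls hβ hγ
  have hl : EqOn (concat σ β γ) β (Ioo t σ) := concat_eqOn_left.mono fun r hr => hr.2
  have hr : EqOn (concat σ β γ) γ (Ioo σ P.T) := concat_eqOn_right.mono fun r hr => hr.1.le
  have hτt : τ ∈ Icc t P.T := ⟨hσ.1.trans hτ.1, hτ.2⟩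
  have hz : P.traj x t (concat σ β γ) σ = P.traj x t β σ :=
    h.traj_congr hc hβ ht hσ hl x ⟨hσ.1, le_rfl⟩
  have hzτ : P.traj x t (concat σ β γ) τ = P.traj (P.traj x t β σ) σ γ τ := by
    rw [h.traj_traj hc hγ ht hσ hr x hτ, hz]
  refine ⟨(⟨_, hc⟩, ⟨τ, hτt⟩), hτ.1, concat_eqOn_left.symm, ?_, ?_⟩
  · have h1 := h.V_le_ψ (x := P.traj (P.traj x t β σ) σ γ τ) ⟨ht.1.trans hτt.1, hτt.2⟩
    have h2 : P.cost P.V (P.traj x t β σ) σ γ τ ≤ P.V (P.traj x t β σ) σ + ε :=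
      (cost_mono h1).trans hJ.le
    have h3 := mul_le_mul_of_nonneg_left h2 (Real.exp_pos (-P.lam * (σ - t))).le
    have h4 := mul_le_of_le_one_left hε.le (h.exp_le_one hσ.1)
    simp only
    rw [h.cost_split hc hγ ht hσ hτ hr, h.cost_congr hc hβ ht hσ hl]
    simp only [cost] at h3 ⊢
    linarith
  · have h1 := h.V_le_cost_V (x := P.traj x t β σ) hγ hσ0 hτ
    simp only
    rw [hzτ]
    rw [J_eq_cost, cost] at hJ
    rw [cost] at h1
    set w := P.ψ (P.traj (P.traj x t β σ) σ γ τ) τ - P.V (P.traj (P.traj x t β σ) σ γ τ) τ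
    have h2 : Real.exp (-P.lam * (τ - σ)) * w ≤ ε := by rw [mul_sub]; linarith
    have h3 : Real.exp (P.lam * (τ - σ)) * Real.exp (-P.lam * (τ - σ)) = 1 := by
      rw [← Real.exp_add]; simp
    have h4 : Real.exp (P.lam * (τ - σ)) ≤ Real.exp (P.lam * P.T) :=
      Real.exp_le_exp.2 (mul_le_mul_of_nonneg_left (by linarith [hτ.2, hσ0.1]) h.lam_nonneg)
    calc w = Real.exp (P.lam * (τ - σ)) * (Real.exp (-P.lam * (τ - σ)) * w) := by
          rw [← mul_assoc, h3, one_mul]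
      _ ≤ Real.exp (P.lam * (τ - σ)) * ε := mul_le_mul_of_nonneg_left h2 (Real.exp_pos _).le
      _ ≤ ε * Real.exp (P.lam * P.T) := by
          rw [mul_comm]; exact mul_le_mul_of_nonneg_left h4 hε.le

/-- Some control makes stopping at the first contact almost optimal. Continuations with
tolerances `ε / 2 ^ (n + 1)` give times that increase to a limit; the gap between obstacle and value
function tends to zero along them, so by continuity contact occurs no later than this limit, even
if the horizon is not reached. -/
theorem exists_J_hitTime_le (h : P.IsRegular M L C) (ht : t ∈ Icc 0 P.T)
    (x : EuclideanSpace ℝ (Fin d)) {ε : ℝ} (hε : 0 < ε) :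
    ∃ α ∈ P.controls, P.J x t α (P.hitTime P.V x t α) ≤ P.V x t + ε := by
  have hε' : ∀ n : ℕ, 0 < ε / 2 ^ (n + 1) := fun n => by positivity
  choose F hF1 hF2 hF3 hF4 using fun (n : ℕ) (q : P.controls × Icc t P.T) =>
    h.exists_continuation ht x q (hε' n)
  obtain ⟨⟨α₀, hα₀⟩⟩ := h.nonempty_controls
  obtain ⟨q, hq0, hq⟩ : ∃ q : ℕ → P.controls × Icc t P.T,
      q 0 = (⟨α₀, hα₀⟩, ⟨t, le_rfl, ht.2⟩) ∧ ∀ n, q (n + 1) = F n (q n) :=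
    ⟨fun n => Nat.rec (⟨α₀, hα₀⟩, ⟨t, le_rfl, ht.2⟩) (fun n p => F n p) n, rfl, fun _ => rfl⟩
  have hmono : Monotone fun n => ((q n).2 : ℝ) := monotone_nat_of_le_succ fun n => by
    rw [hq]; exact hF1 n (q n)
  obtain ⟨α, hα, hαq⟩ := exists_control_eqOn (P := P) (β := fun n => (q n).1)
    (fun n => (q n).1.2) hmono (fun n => by rw [hq]; exact hF2 n (q n))
  have hcost : ∀ n, P.cost P.V x t (q n).1 (q n).2 ≤ P.V x t + ε * (1 - 1 / 2 ^ n) := by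
    intro n
    induction n with
    | zero =>
      rw [hq0, h.cost_self hα₀ ht]
      simp
    | succ n ih =>
      rw [hq]
      refine (hF3 n (q n)).trans ?_
      have : ε * (1 - 1 / 2 ^ (n + 1)) = ε * (1 - 1 / 2 ^ n) + ε / 2 ^ (n + 1) := by
        field_simp
        ring
      linarith
  have hcong : ∀ n, EqOn α ((q n).1 : ℝ → EuclideanSpace ℝ (Fin m)) (Ioo t ((q n).2 : ℝ)) := fun n =>
    (hαq n).mono fun r hr => hr.2
  have htraj : ∀ n, P.traj x t α (q n).2 = P.traj x t (q n).1 (q n).2 := fun n =>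
    h.traj_congr hα (q n).1.2 ht (q n).2.2 (hcong n) x ⟨(q n).2.2.1, le_rfl⟩
  have hbdd : BddAbove (range fun n => ((q n).2 : ℝ)) :=
    ⟨P.T, by rintro _ ⟨n, rfl⟩; exact (q n).2.2.2⟩
  set σ := ⨆ n, ((q n).2 : ℝ)
  have hσlim : Tendsto (fun n => ((q n).2 : ℝ)) atTop (𝓝 σ) := tendsto_atTop_ciSup hmono hbdd
  have hσ : σ ∈ Icc t P.T :=
    isClosed_Icc.mem_of_tendsto hσlim (Eventually.of_forall fun n => (q n).2.2)
  have hσwithin : Tendsto (fun n => ((q n).2 : ℝ)) atTop (𝓝[Icc t P.T] σ) :=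
    tendsto_nhdsWithin_iff.2 ⟨hσlim, Eventually.of_forall fun n => (q n).2.2⟩
  have hcostσ : P.cost P.V x t α σ ≤ P.V x t + ε := by
    refine le_of_tendsto (((h.continuousOn_cost hα ht h.isBUC_V.2.continuousOn x) σ hσ).tendsto.comp
      hσwithin) (Eventually.of_forall fun n => ?_)
    simp only [Function.comp]
    rw [h.cost_congr hα (q n).1.2 ht (q n).2.2 (hcong n)]
    refine (hcost n).trans ?_
    have : 0 ≤ ε * (1 / 2 ^ n) := by positivity
    linarith
  have hcontact : P.ψ (P.traj x t α σ) σ ≤ P.V (P.traj x t α σ) σ := by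
    have hc := (h.continuousOn_along_traj hα ht h.ψ_cont.continuousOn x).sub
      (h.continuousOn_along_traj hα ht h.isBUC_V.2.continuousOn x)
    have hgap := (hc σ hσ).tendsto.comp (hσwithin.comp (tendsto_add_atTop_nat 1))
    have hzero : Tendsto (fun n : ℕ => ε / 2 ^ (n + 1) * Real.exp (P.lam * P.T)) atTop (𝓝 0) := by
      have h1 : Tendsto (fun n : ℕ => (1 / 2 : ℝ) ^ (n + 1)) atTop (𝓝 0) :=
        (tendsto_pow_atTop_nhds_zero_of_lt_one (by norm_num) (by norm_num)).comp
          (tendsto_add_atTop_nat 1)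
      have h2 := (h1.const_mul ε).mul_const (Real.exp (P.lam * P.T))
      rw [mul_zero, zero_mul] at h2
      refine h2.congr fun n => ?_
      rw [one_div, inv_pow, div_eq_mul_inv]
    refine sub_nonpos.1 (le_of_tendsto_of_tendsto' hgap hzero fun n => ?_)
    have h1 := hF4 n (q n)
    rw [← hq, ← htraj] at h1
    exact h1
  have hσ0 : σ ∈ Icc 0 P.T := ⟨ht.1.trans hσ.1, hσ.2⟩
  obtain ⟨hmem, heq⟩ := h.hitTime_mem hα ht x
  have hle : P.hitTime P.V x t α ≤ σ :=
    csInf_le ⟨t, fun _ hτ => hτ.1.1⟩ ⟨hσ, le_antisymm (h.V_le_ψ hσ0) hcontact⟩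
  refine ⟨α, hα, ?_⟩
  calc P.J x t α (P.hitTime P.V x t α) ≤ P.cost P.V x t α (P.hitTime P.V x t α) := cost_mono heq.ge
    _ ≤ P.J x t α σ := h.cost_V_le_J hα ht hmem ⟨hle, hσ.2⟩
    _ ≤ P.cost P.V x t α σ := cost_mono hcontact
    _ ≤ P.V x t + ε := hcostσ

theorem V_eq_iInf_hitTime (h : P.IsRegular M L C) (ht : t ∈ Icc 0 P.T)
    (x : EuclideanSpace ℝ (Fin d)) :
    P.V x t = ⨅ α : P.controls, P.J x t α (P.hitTime P.V x t α) := by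
  have : Nonempty P.controls := h.nonempty_controls
  refine le_antisymm (le_ciInf fun α => h.V_le_J α.2 ht (h.hitTime_mem α.2 ht x).1)
    (le_of_forall_pos_le_add fun ε hε => ?_)
  obtain ⟨α, hα, hJ⟩ := h.exists_J_hitTime_le ht x hε
  refine (ciInf_le ⟨0, ?_⟩ (⟨α, hα⟩ : P.controls)).trans hJ
  rintro _ ⟨α, rfl⟩
  exact h.J_nonneg α.2 ht (h.hitTime_mem α.2 ht x).1

end IsRegular

/-- The contact time only depends on the values of `u` at times in `[0, T]`. -/
theorem hitTime_congr {u v : EuclideanSpace ℝ (Fin d) → ℝ → ℝ} (ht : 0 ≤ t)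
    (huv : ∀ x, ∀ t ∈ Icc 0 P.T, u x t = v x t) : P.hitTime u x t α = P.hitTime v x t α := by
  unfold hitTime
  congr 1
  ext τ
  exact and_congr_right fun hτ => by rw [huv _ _ ⟨ht.trans hτ.1, hτ.2⟩]

end StoppingProblem

end

theorem mainTheorem1 {d m : ℕ} (P : StoppingProblem d m)
    (hT : 0 < P.T) (hlam : 0 ≤ P.lam)
    (hA : IsCompact P.A) (hAne : P.A.Nonempty)
    -- the dynamics: continuous, bounded, Lipschitz in `x` uniformly in `a`
    (hf_cont : ContinuousOn
      (fun z : EuclideanSpace ℝ (Fin d) × EuclideanSpace ℝ (Fin m) => P.f z.1 z.2)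
      (Set.univ ×ˢ P.A))
    (hf_bdd : ∃ M : ℝ, ∀ x, ∀ a ∈ P.A, ‖P.f x a‖ ≤ M)
    (hf_lip : ∃ L : ℝ, 0 < L ∧ ∀ x y, ∀ a ∈ P.A, ‖P.f x a - P.f y a‖ ≤ L * ‖x - y‖)
    -- the stopping cost: nonnegative, bounded, uniformly continuous
    (hψ_nonneg : ∀ x, ∀ t ∈ Set.Icc 0 P.T, 0 ≤ P.ψ x t)
    (hψ_buc : P.IsBUC P.ψ)
    -- the running cost: nonnegative, bounded, continuous, with a modulus of continuity in `x`
    (hℓ_nonneg : ∀ x, ∀ a ∈ P.A, ∀ t ∈ Set.Icc 0 P.T, 0 ≤ P.ℓ x a t)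
    (hℓ_bdd : ∃ C : ℝ, ∀ x, ∀ a ∈ P.A, ∀ t ∈ Set.Icc 0 P.T, P.ℓ x a t ≤ C)
    (hℓ_cont : ContinuousOn
      (fun z : EuclideanSpace ℝ (Fin d) × EuclideanSpace ℝ (Fin m) × ℝ => P.ℓ z.1 z.2.1 z.2.2)
      (Set.univ ×ˢ P.A ×ˢ Set.Icc 0 P.T))
    (hℓ_mod : ∃ ω : ℝ → ℝ, Filter.Tendsto ω (nhdsWithin 0 (Set.Ici 0)) (nhds 0) ∧
      ∀ x y, ∀ a ∈ P.A, ∀ t ∈ Set.Icc 0 P.T, |P.ℓ x a t - P.ℓ y a t| ≤ ω ‖x - y‖) :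
    (∀ u : EuclideanSpace ℝ (Fin d) → ℝ → ℝ, P.IsBUCViscositySolution u →
      ∀ x, ∀ t ∈ Set.Icc 0 P.T,
        u x t = (⨅ α : P.controls, P.J x t α (P.hitTime u x t α)) ∧
        u x t = P.V x t) ∧
    P.IsBUCViscositySolution P.V := by
  obtain ⟨M, hM⟩ := hf_bdd
  obtain ⟨L, hL, hLip⟩ := hf_lip
  obtain ⟨⟨C₁, hC₁⟩, hψ⟩ := hψ_buc
  obtain ⟨C₂, hC₂⟩ := hℓ_bdd
  obtain ⟨ω, hω, hωℓ⟩ := hℓ_mod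
  have h : P.IsRegular M L (max C₁ C₂) :=
    { T_pos := hT
      lam_nonneg := hlam
      isCompact := hA
      nonempty := hAne
      f_cont := hf_cont
      f_le := hM
      L_pos := hL
      f_lip := hLip
      ψ_nonneg := hψ_nonneg
      ψ_le := fun x t ht => ((le_abs_self _).trans (hC₁ x t ht)).trans (le_max_left _ _)
      ψ_cont := hψ
      ℓ_nonneg := hℓ_nonneg
      ℓ_le := fun x a ha t ht => (hC₂ x a ha t ht).trans (le_max_right _ _)
      ℓ_cont := hℓ_cont
      ℓ_unif := fun ε hε => by
        obtain ⟨δ, hδ, hball⟩ := Metric.mem_nhdsWithin_iff.1 (hω.eventually_lt_const hε)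
        refine ⟨δ, hδ, fun x y a ha t ht hxy => (hωℓ x y a ha t ht).trans_lt
          (hball ⟨?_, norm_nonneg _⟩)⟩
        rwa [Metric.mem_ball, dist_zero_right, norm_norm] }
  refine ⟨fun u hu x t ht => ?_, h.isBUCViscositySolution_V⟩
  have huV : ∀ x, ∀ t ∈ Icc 0 P.T, u x t = P.V x t := fun x t ht =>
    h.eq_V_of_isBUCViscositySolution hu x ht
  refine ⟨?_, huV x t ht⟩
  rw [huV x t ht, h.V_eq_iInf_hitTime ht x]
  exact iInf_congr fun α => by rw [StoppingProblem.hitTime_congr ht.1 huV]
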